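/- Let $N\ge 1$ be an integer, let $\hbar,g,\kappa>0$ and put $\rho=\kappa g^{2N}$. Let $\delta=(\delta_1,\dots,\delta_N)\in\mathbb C^N$ be a tuple that is invariant (with multiplicities) under complex conjugation and satisfies $|\operatorname{Im}\delta_k|<\hbar/2$ for all $k$, and put $\vartheta(\lambda)=\prod_{k=1}^N(\lambda-\delta_k)$. Let $Y_\delta:\mathbb R\to(0,\infty)$ be such that $\ln Y_\delta$ is continuous, nonnegative and bounded and solves the nonlinear integral equation $$\ln Y_\delta(\lambda)=\int_{\mathbb R}\frac{\hbar}{\pi\big((\lambda-\mu)^2+\hbar^2\big)}\,\ln\Big(1+\frac{\rho^\hbar\,Y_\delta(\mu)}{|\vartheta(\mu-i\hbar/2)|^2}\Big)\,d\mu\qquad(\lambda\in\mathbb R).$$ Then the integrals in $$\ln v_\uparrow(\lambda)=-\int_{\mathbb R}\frac{d\mu}{2i\pi}\,\frac{1}{\lambda-\mu+i\hbar/2}\,\ln\Big(1+\frac{\rho^\hbar Y_\delta(\mu)}{\vartheta(\mu-i\hbar/2)\vartheta(\mu+i\hbar/2)}\Big)\qquad(\operatorname{Im}\lambda>-\hbar/2),$$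 $$\ln v_\downarrow(\lambda-i\hbar)=\int_{\mathbb R}\frac{d\mu}{2i\pi}\,\frac{1}{\lambda-\mu-i\hbar/2}\,\ln\Big(1+\frac{\rho^\hbar Y_\delta(\mu)}{\vartheta(\mu-i\hbar/2)\vartheta(\mu+i\hbar/2)}\Big)\qquad(\operatorname{Im}\lambda<\hbar/2)$$ converge absolutely, and the functions $$Q_\delta^+(\lambda)=\frac{(\kappa g^N)^{-i\lambda}\,\hbar^{iN\lambda/\hbar}\,e^{-N\pi\lambda/\hbar}\,v_\uparrow(\lambda)}{\prod_{k=1}^N\Gamma\big(1-i(\lambda-\delta_k)/\hbar\big)}\quad(\operatorname{Im}\lambda>-\hbar/2),$$ $$Q_\delta^-(\lambda)=\frac{g^{iN\lambda}\,\hbar^{-iN\lambda/\hbar}\,e^{-N\pi\lambda/\hbar}\,v_\downarrow(\lambda-i\hbar)}{\prod_{k=1}^N\Gamma\big(1+i(\lambda-\delta_k)/\hbar\big)}\quad(\operatorname{Im}\lambda<\hbar/2)$$ extend to entire functions of $\lambda$, still denoted $Q_\delta^\pm$. Moreover, both as $\operatorname{Re}\lambda\to+\infty$ and as $\operatorname{Re}\lambda\to-\infty$,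 each of the two functions satisfies $$|Q_\delta^\pm(\lambda)|=\big|e^{-N\pi\lambda/\hbar}\big|\cdot O\Big(e^{\frac{N\pi}{2\hbar}|\operatorname{Re}\lambda|}\,|\lambda|^{\frac{N}{2\hbar}(\mp2\operatorname{Im}\lambda-\hbar)}\Big),$$ with the upper sign for $Q_\delta^+$ and the lower sign for $Q_\delta^-$, uniformly in the closed strip $|\operatorname{Im}\lambda|\le\hbar/2$. -/

import Mathlib

noncomputable section

namespace TodaTBA

/-- The monic polynomial `ϑ(z) = ∏ₖ (z - δₖ)` with prescribed roots. -/
def vartheta {N : ℕ} (δ : Fin N → ℂ) (z : ℂ) : ℂ := ∏ k, (z - δ k)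

/-- The tuple `δ` is invariant, with multiplicities, under complex conjugation. -/
def SelfConjugate {N : ℕ} (δ : Fin N → ℂ) : Prop :=
  ∃ σ : Equiv.Perm (Fin N), ∀ k, (starRingEnd ℂ) (δ k) = δ (σ k)

/-- The deformation parameter `ρ = κ g^(2N)`. -/
def rho (N : ℕ) (g κ : ℝ) : ℝ := κ * g ^ (2 * N)

/-- The kernel `K(x) = ħ / (π (x² + ħ²))`. -/
def kernelK (hbar x : ℝ) : ℝ := hbar / (Real.pi * (x ^ 2 + hbar ^ 2))

/-- `Y` is positive on the real line, `log Y` is continuous, nonnegative and bounded there, and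
`log Y(x) = ∫ K(x - μ) log (1 + ρ^ħ Y(μ) / |ϑ(μ - iħ/2)|²) dμ` for all real `x`. -/
structure IsNLIESolution {N : ℕ} (hbar g κ : ℝ) (δ : Fin N → ℂ) (Y : ℝ → ℝ) : Prop where
  pos : ∀ x, 0 < Y x
  continuous_log : Continuous fun x => Real.log (Y x)
  log_nonneg : ∀ x, 0 ≤ Real.log (Y x)
  log_bounded : ∃ C : ℝ, ∀ x, Real.log (Y x) ≤ C
  nlie : ∀ x, Real.log (Y x) = ∫ μ : ℝ, kernelK hbar (x - μ) *
    Real.log (1 + rho N g κ ^ hbar * Y μ /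
      ‖vartheta δ ((μ : ℂ) - Complex.I * hbar / 2)‖ ^ 2)

/-- `ln (1 + ρ^ħ Y(μ) / (ϑ(μ - iħ/2) ϑ(μ + iħ/2)))` for real `μ`. -/
def logV {N : ℕ} (hbar g κ : ℝ) (δ : Fin N → ℂ) (Y : ℝ → ℝ) (μ : ℝ) : ℂ :=
  Complex.log (1 + ((rho N g κ ^ hbar * Y μ : ℝ) : ℂ) /
    (vartheta δ ((μ : ℂ) - Complex.I * hbar / 2) * vartheta δ ((μ : ℂ) + Complex.I * hbar / 2)))

/-- The integrand of `ln v↑(z)`, without its sign. -/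
def upIntegrand {N : ℕ} (hbar g κ : ℝ) (δ : Fin N → ℂ) (Y : ℝ → ℝ) (z : ℂ) (μ : ℝ) : ℂ :=
  1 / (2 * Complex.I * Real.pi) * (1 / (z - μ + Complex.I * hbar / 2)) * logV hbar g κ δ Y μ

/-- The integrand of `ln v↓(z - iħ)`. -/
def downIntegrand {N : ℕ} (hbar g κ : ℝ) (δ : Fin N → ℂ) (Y : ℝ → ℝ) (z : ℂ) (μ : ℝ) : ℂ :=
  1 / (2 * Complex.I * Real.pi) * (1 / (z - μ - Complex.I * hbar / 2)) * logV hbar g κ δ Y μ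

/-- `v↑(z)`, given by its integral representation in the half-plane `Im z > -ħ/2`. -/
def vUp {N : ℕ} (hbar g κ : ℝ) (δ : Fin N → ℂ) (Y : ℝ → ℝ) (z : ℂ) : ℂ :=
  Complex.exp (-∫ μ : ℝ, upIntegrand hbar g κ δ Y z μ)

/-- `v↓(z - iħ)` as a function of `z`, given by its integral representation in the half-plane
`Im z < ħ/2`. -/
def vDownShift {N : ℕ} (hbar g κ : ℝ) (δ : Fin N → ℂ) (Y : ℝ → ℝ) (z : ℂ) : ℂ :=
  Complex.exp (∫ μ : ℝ, downIntegrand hbar g κ δ Y z μ)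

/-- The expression for `Q⁺(z)` in the half-plane `Im z > -ħ/2`. -/
def QplusExpr {N : ℕ} (hbar g κ : ℝ) (δ : Fin N → ℂ) (Y : ℝ → ℝ) (z : ℂ) : ℂ :=
  ((κ * g ^ N : ℝ) : ℂ) ^ (-Complex.I * z) * (hbar : ℂ) ^ (Complex.I * N * z / hbar) *
      Complex.exp (-(N * Real.pi / hbar) * z) * vUp hbar g κ δ Y z /
    ∏ k, Complex.Gamma (1 - Complex.I * (z - δ k) / hbar)

/-- The expression for `Q⁻(z)` in the half-plane `Im z < ħ/2`. -/
def QminusExpr {N : ℕ} (hbar g κ : ℝ) (δ : Fin N → ℂ) (Y : ℝ → ℝ) (z : ℂ) : ℂ :=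
  (g : ℂ) ^ (Complex.I * N * z) * (hbar : ℂ) ^ (-Complex.I * N * z / hbar) *
      Complex.exp (-(N * Real.pi / hbar) * z) * vDownShift hbar g κ δ Y z /
    ∏ k, Complex.Gamma (1 + Complex.I * (z - δ k) / hbar)

/-- The filter "`Re z → ±∞` inside the closed strip `|Im z| ≤ ħ/2`". A `=O` along it is
uniform in the strip, with respect to `Im z`, and covers both ends of the strip. -/
def stripEnds (hbar : ℝ) : Filter ℂ :=
  Filter.comap (fun z : ℂ => |z.re|) Filter.atTop ⊓ Filter.principal {z : ℂ | |z.im| ≤ hbar / 2}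

end TodaTBA

end

open MeasureTheory Filter Topology Set

/-! Write `A` for v↑ and `B z` for v↓(z - iħ). Since δ is self-conjugate, the density L = ln(1 + ρ^ħ
Y/|ϑ|²) is real and nonnegative. It is O(1/(1 + μ²)), so both integrals are Cauchy transforms of an
integrable function.

Continuation. Partial fractions of the kernel turn the integral equation into Y(x) = A(x + iħ/2) B(x
- iħ/2). Hence e^L is the restriction to ℝ of W = 1 + ρ^ħ A(· + iħ/2) B(· - iħ/2)/(ϑ(· - iħ/2) ϑ(· +
iħ/2)), holomorphic near ℝ. By the Plemelj jump (`cauchyTransform_continuation`), A therefore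
continues just below Im z = -ħ/2 as W(z + iħ/2)/B(z + iħ). Multiply by G = ∏ 1/Γ. As G(z) contains
the factor ϑ(z + iħ), one of the two ϑ's in the denominator cancels, and E = A·G satisfies E(z) =
p(z) + q(z) E(z + iħ) with p, q holomorphic for Im z < -ħ/2: the zeros of ϑ lie in |Im z| < ħ/2 and
B = exp(…) never vanishes. Iterating this relation (`exists_entire_extension`) makes E entire.

Growth. The Poisson kernel gives |A| ≤ e^(D/2) if L ≤ D, and by continuity |E| ≤ e^(D/2)|G| also on
the line Im z = -ħ/2. What remains is a Stirling bound for 1/Γ (`exists_norm_Gamma_inv_le`),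
obtained from Phragmén–Lindelöf and the reflection formula. The case of Q⁻ follows by the reflection
z ↦ conj (E (conj z)). -/

namespace TodaTBA

/-! ### Holomorphic dependence of integrals on a parameter. -/

/-- An integral of holomorphic functions dominated by an integrable function is holomorphic. -/
theorem differentiableOn_integral_of_dominated {α : Type*} [MeasurableSpace α] {m : Measure α}
    {U : Set ℂ} (hU : IsOpen U) {F : ℂ → α → ℂ} {b : α → ℝ} (hb : Integrable b m)
    (hmeas : ∀ z ∈ U, AEStronglyMeasurable (F z) m)
    (hdiff : ∀ᵐ a ∂m, DifferentiableOn ℂ (fun z => F z a) U)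
    (hbound : ∀ᵐ a ∂m, ∀ z ∈ U, ‖F z a‖ ≤ b a) :
    DifferentiableOn ℂ (fun z => ∫ a, F z a ∂m) U := by
  intro z₀ hz₀
  obtain ⟨ε, hε, hball⟩ := Metric.isOpen_iff.1 hU z₀ hz₀
  have hr : 0 < ε / 2 := by positivity
  have hcl : ∀ x ∈ Metric.ball z₀ (ε / 2), Metric.closedBall x (ε / 4) ⊆ U := by
    intro x hx y hy
    apply hball
    rw [Metric.mem_ball] at hx ⊢
    rw [Metric.mem_closedBall] at hy
    linarith [dist_triangle y x z₀]
  -- Measurability is assumed only for each fixed z; the derivative inherits it as a limit of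
  -- difference quotients along a real sequence.
  have hderiv : AEStronglyMeasurable (fun a => deriv (fun z => F z a) z₀) m := by
    have hlim : Tendsto (fun n : ℕ => (((ε / 2) / ((n : ℝ) + 1) : ℝ) : ℂ)) atTop (𝓝 0) := by
      rw [← Complex.ofReal_zero]
      refine (Complex.continuous_ofReal.tendsto 0).comp ?_
      have := (tendsto_one_div_add_atTop_nhds_zero_nat (𝕜 := ℝ)).const_mul (ε / 2)
      simpa [div_eq_mul_inv] using this
    have hpos : ∀ n : ℕ, 0 < (ε / 2) / ((n : ℝ) + 1) := fun n => by positivity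
    have hlt : ∀ n : ℕ, (ε / 2) / ((n : ℝ) + 1) < ε := fun n => by
      rw [div_lt_iff₀ (by positivity)]
      nlinarith [(Nat.cast_nonneg n : (0 : ℝ) ≤ n)]
    refine aestronglyMeasurable_of_tendsto_ae (u := atTop)
      (f := fun (n : ℕ) a => (((ε / 2) / ((n : ℝ) + 1) : ℝ) : ℂ)⁻¹ •
        (F (z₀ + (((ε / 2) / ((n : ℝ) + 1) : ℝ) : ℂ)) a - F z₀ a)) ?_ ?_
    · intro n
      refine ((hmeas _ (hball ?_)).sub (hmeas _ hz₀)).const_smul (_ : ℂ)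
      rw [Metric.mem_ball, dist_self_add_left, Complex.norm_real, Real.norm_of_nonneg (hpos n).le]
      exact hlt n
    · filter_upwards [hdiff] with a ha
      have hd := (ha.differentiableAt (hU.mem_nhds hz₀)).hasDerivAt
      rw [hasDerivAt_iff_tendsto_slope_zero] at hd
      refine hd.comp (tendsto_nhdsWithin_iff.2 ⟨hlim, Eventually.of_forall fun n => ?_⟩)
      simpa [-Complex.ofReal_div] using (hpos n).ne'
  have hint : Integrable (F z₀) m :=
    hb.mono' (hmeas _ hz₀) (hbound.mono fun a ha => ha z₀ hz₀)
  -- The dominating function is the Cauchy estimate on circles of radius ε/4, which stay in U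
  -- because ε/2 + ε/4 < ε.
  refine ((hasDerivAt_integral_of_dominated_loc_of_deriv_le
    (F' := fun z a => deriv (fun z => F z a) z) (bound := fun a => b a / (ε / 4))
    (Metric.ball_mem_nhds z₀ hr) ?_ hint hderiv ?_ (hb.div_const _)
    ?_).2.differentiableAt).differentiableWithinAt
  · exact (hU.eventually_mem hz₀).mono hmeas
  · filter_upwards [hdiff, hbound] with a ha hba x hx
    refine Complex.norm_deriv_le_of_forall_mem_sphere_norm_le (by positivity) ?_ ?_
    · refine (ha.mono ?_).diffContOnCl
      rw [closure_ball _ (by positivity)]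
      exact hcl x hx
    · exact fun z hz => hba z (hcl x hx (Metric.sphere_subset_closedBall hz))
  · filter_upwards [hdiff] with a ha x hx
    exact (ha.differentiableAt (hU.mem_nhds (hcl x hx
      (Metric.mem_closedBall_self (by positivity))))).hasDerivAt

/-! ### The Cauchy transform off the real line. -/

/-- The Cauchy transform `z ↦ ∫ L(μ) / (z - μ) dμ` of a function on the real line. -/
noncomputable def cauchyTransform (L : ℝ → ℂ) (z : ℂ) : ℂ := ∫ μ : ℝ, L μ / (z - μ)

theorem sub_ofReal_ne_zero {z : ℂ} (hz : z.im ≠ 0) (μ : ℝ) : z - μ ≠ 0 := by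
  intro h
  apply hz
  simpa using congrArg Complex.im h

theorem norm_div_sub_ofReal_le (c : ℂ) {z : ℂ} {d : ℝ} (hd : 0 < d) (hz : d ≤ |z.im|) (μ : ℝ) :
    ‖c / (z - μ)‖ ≤ ‖c‖ * d⁻¹ := by
  have h : d ≤ ‖z - μ‖ := hz.trans (by simpa using Complex.abs_im_le_norm (z - μ))
  rw [norm_div, div_eq_mul_inv]
  gcongr

theorem aestronglyMeasurable_div_sub {L : ℝ → ℂ} {m : Measure ℝ} (hL : AEStronglyMeasurable L m)
    (z : ℂ) : AEStronglyMeasurable (fun μ : ℝ => L μ / (z - μ)) m := by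
  have : Measurable fun μ : ℝ => (z - (μ : ℂ))⁻¹ := by fun_prop
  simp only [div_eq_mul_inv]
  exact hL.mul this.aestronglyMeasurable

theorem integrable_div_sub {L : ℝ → ℂ} (hL : Integrable L) {z : ℂ} (hz : z.im ≠ 0) :
    Integrable fun μ : ℝ => L μ / (z - μ) :=
  (hL.norm.mul_const _).mono' (aestronglyMeasurable_div_sub hL.1 z)
    (Eventually.of_forall fun μ => norm_div_sub_ofReal_le (L μ) (abs_pos.2 hz) le_rfl μ)

/-- The Cauchy transform over a set is holomorphic at the points at positive distance from it. -/
theorem differentiableAt_setIntegral_div_sub {L : ℝ → ℂ} (hL : Integrable L) {S : Set ℝ}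
    (hS : MeasurableSet S) {z₀ : ℂ} {d : ℝ} (hd : 0 < d)
    (hdist : ∀ μ ∈ S, ∀ z ∈ Metric.ball z₀ d, d ≤ ‖z - μ‖) :
    DifferentiableAt ℂ (fun z => ∫ μ in S, L μ / (z - μ)) z₀ := by
  refine (differentiableOn_integral_of_dominated (U := Metric.ball z₀ d) Metric.isOpen_ball
    (b := fun μ => ‖L μ‖ * d⁻¹) (hL.norm.mul_const _).integrableOn
    (fun z _ => aestronglyMeasurable_div_sub hL.1.restrict z) ?_ ?_).differentiableAt
    (Metric.ball_mem_nhds z₀ hd)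
  · filter_upwards [ae_restrict_mem hS] with μ hμ z hz
    have : z - μ ≠ 0 := norm_pos_iff.1 (hd.trans_le (hdist μ hμ z hz))
    exact (by fun_prop (disch := assumption) :
      DifferentiableAt ℂ (fun z : ℂ => L μ / (z - μ)) z).differentiableWithinAt
  · filter_upwards [ae_restrict_mem hS] with μ hμ z hz
    rw [norm_div, div_eq_mul_inv]
    have := hdist μ hμ z hz
    gcongr

theorem differentiableAt_cauchyTransform {L : ℝ → ℂ} (hL : Integrable L) {z : ℂ}
    (hz : z.im ≠ 0) : DifferentiableAt ℂ (cauchyTransform L) z := by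
  have h := differentiableAt_setIntegral_div_sub hL MeasurableSet.univ (z₀ := z)
    (d := |z.im| / 2) (by positivity) ?_
  · rwa [Measure.restrict_univ] at h
  · intro μ _ w hw
    have h1 : |w.im - z.im| < |z.im| / 2 := by
      simpa using (Complex.abs_im_le_norm (w - z)).trans_lt (by simpa [dist_eq_norm] using hw)
    have h2 : |w.im| ≤ ‖w - μ‖ := by simpa using Complex.abs_im_le_norm (w - μ)
    have h3 := abs_sub_abs_le_abs_sub z.im w.im
    rw [abs_sub_comm] at h3
    linarith

/-! ### Continuation of the Cauchy transform across the line. -/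

theorem dslope_symm (f : ℂ → ℂ) (a b : ℂ) : dslope f a b = dslope f b a := by
  rcases eq_or_ne a b with rfl | h
  · rfl
  · rw [dslope_of_ne _ h.symm, dslope_of_ne _ h, slope_comm]

/-- The logarithm changes by `iπ` under negation in the lower half-plane. -/
theorem log_neg_of_im_neg {w : ℂ} (hw : w.im < 0) :
    Complex.log (-w) = Complex.log w + Real.pi * Complex.I := by
  rw [Complex.log, Complex.log, norm_neg, Complex.arg_neg_eq_arg_add_pi_of_im_neg hw]
  push_cast; ring

theorem log_neg_of_im_pos {w : ℂ} (hw : 0 < w.im) :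
    Complex.log (-w) = Complex.log w - Real.pi * Complex.I := by
  rw [Complex.log, Complex.log, norm_neg, Complex.arg_neg_eq_arg_sub_pi_of_im_pos hw]
  push_cast; ring

/-- The path z - μ has constant nonzero imaginary part, so it never meets the cut of the principal
logarithm. -/
theorem intervalIntegral_inv_sub {a b : ℝ} {z : ℂ} (hz : z.im ≠ 0) :
    ∫ μ in a..b, (z - μ)⁻¹ = Complex.log (z - a) - Complex.log (z - b) := by
  have hd : ∀ x ∈ uIcc a b,
      HasDerivAt (fun x : ℝ => -Complex.log (z - x)) ((z - x)⁻¹) x := by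
    intro x _
    have h1 : HasDerivAt (fun x : ℝ => z - (x : ℂ)) (-1) x := by
      simpa using (Complex.ofRealCLM.hasDerivAt (x := x)).const_sub z
    have h2 := (h1.clog_real (Or.inr (by simpa using hz))).neg
    rw [neg_div, neg_neg, one_div] at h2
    exact h2
  rw [intervalIntegral.integral_eq_sub_of_hasDerivAt hd]
  · ring
  · refine ContinuousOn.intervalIntegrable fun x _ => ContinuousAt.continuousWithinAt ?_
    have := sub_ofReal_ne_zero hz x
    fun_prop (disch := assumption)

/-- The integral of the divided difference of a holomorphic function is holomorphic. -/
theorem differentiableOn_integral_dslope {l : ℂ → ℂ} {c : ℂ} {r R : ℝ} (hrR : r < R)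
    (hl : DifferentiableOn ℂ l (Metric.ball c R)) {a b : ℝ}
    (hab : ∀ μ ∈ Set.Ioc a b, (μ : ℂ) ∈ Metric.ball c r) :
    DifferentiableOn ℂ (fun z => ∫ μ in Set.Ioc a b, dslope l (μ : ℂ) z) (Metric.ball c r) := by
  have hsub : Metric.closedBall c r ⊆ Metric.ball c R := Metric.closedBall_subset_ball hrR
  have hbs : Metric.ball c r ⊆ Metric.ball c R := Metric.ball_subset_closedBall.trans hsub
  have hcd : ContinuousOn (deriv l) (Metric.closedBall c r) :=
    ((hl.analyticOnNhd Metric.isOpen_ball).deriv.continuousOn).mono hsub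
  obtain ⟨K, hK⟩ := (isCompact_closedBall c r).exists_bound_of_continuousOn hcd
  have hdat : ∀ z ∈ Metric.ball c r, DifferentiableAt ℂ l z := fun z hz =>
    hl.differentiableAt (Metric.isOpen_ball.mem_nhds (hbs hz))
  -- Mean value inequality on the convex ball: divided differences are bounded by the supremum of
  -- the derivative.
  have hbd : ∀ w ∈ Metric.ball c r, ∀ z ∈ Metric.ball c r, ‖dslope l w z‖ ≤ K := by
    intro w hw z hz
    rcases eq_or_ne z w with rfl | h
    · rw [dslope_same]; exact hK _ (Metric.ball_subset_closedBall hz)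
    · rw [dslope_of_ne _ h, slope_def_field, norm_div, div_le_iff₀ (norm_pos_iff.2 (sub_ne_zero.2 h))]
      exact (convex_ball c r).norm_image_sub_le_of_norm_deriv_le hdat
        (fun x hx => hK x (Metric.ball_subset_closedBall hx)) hw hz
  refine differentiableOn_integral_of_dominated (b := fun _ => K) Metric.isOpen_ball
    (integrableOn_const (by simp)) ?_ ?_ ?_
  · intro z hz
    have h1 : ContinuousOn (dslope l z) (Metric.ball c r) :=
      (((Complex.differentiableOn_dslope (Metric.isOpen_ball.mem_nhds hz)).2
        (hl.mono hbs)).continuousOn)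
    have h2 : ContinuousOn (fun μ : ℝ => dslope l (μ : ℂ) z) (Set.Ioc a b) := by
      -- Symmetry moves μ into the running slot, where the divided difference based at z is
      -- holomorphic.
      simp only [dslope_symm l _ z]
      exact h1.comp Complex.continuous_ofReal.continuousOn hab
    exact h2.aestronglyMeasurable measurableSet_Ioc
  · filter_upwards [ae_restrict_mem measurableSet_Ioc] with μ hμ
    exact (Complex.differentiableOn_dslope (Metric.isOpen_ball.mem_nhds (hab μ hμ))).2 (hl.mono hbs)
  · filter_upwards [ae_restrict_mem measurableSet_Ioc] with μ hμ z hz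
    exact hbd _ (hab μ hμ) z hz

/-- If the density is the restriction of a function `l` holomorphic near `x₀`, then the Cauchy
transform in the upper half-plane continues analytically across `x₀`, and the continuation
differs from the Cauchy transform in the lower half-plane by `-2πi l`. -/
theorem cauchyTransform_continuation {L : ℝ → ℂ} (hL : Integrable L) {l : ℂ → ℂ} {x₀ R : ℝ}
    (hR : 0 < R) (hl : DifferentiableOn ℂ l (Metric.ball (x₀ : ℂ) R))
    (hlL : ∀ μ : ℝ, (μ : ℂ) ∈ Metric.ball (x₀ : ℂ) R → l μ = L μ) :
    ∃ r > 0, ∃ g : ℂ → ℂ, DifferentiableOn ℂ g (Metric.ball (x₀ : ℂ) r) ∧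
      (∀ z ∈ Metric.ball (x₀ : ℂ) r, 0 < z.im → g z = cauchyTransform L z) ∧
      ∀ z ∈ Metric.ball (x₀ : ℂ) r, z.im < 0 →
        g z = cauchyTransform L z - 2 * Real.pi * Complex.I * l z := by
  set s := R / 3 with hs
  have hs0 : 0 < s := by positivity
  set a := x₀ - s with ha
  set b := x₀ + s with hb
  have hab : a ≤ b := by linarith
  have hmem : ∀ μ ∈ Set.Ioc a b, (μ : ℂ) ∈ Metric.ball (x₀ : ℂ) (2 * s) := by
    intro μ hμ
    rw [Metric.mem_ball, Complex.dist_eq, ← Complex.ofReal_sub, Complex.norm_real, Real.norm_eq_abs,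
      abs_lt]
    constructor <;> linarith [hμ.1, hμ.2]
  have hsR : 2 * s < R := by linarith
  have hsub : Metric.ball (x₀ : ℂ) (s / 2) ⊆ Metric.ball (x₀ : ℂ) (2 * s) :=
    Metric.ball_subset_ball (by linarith)
  have hsub2 : Metric.ball (x₀ : ℂ) (2 * s) ⊆ Metric.ball (x₀ : ℂ) R :=
    Metric.ball_subset_ball hsR.le
  have hre : ∀ z ∈ Metric.ball (x₀ : ℂ) (s / 2), a < z.re ∧ z.re < b := by
    intro z hz
    have := (Complex.abs_re_le_norm (z - x₀)).trans_lt (by simpa [dist_eq_norm] using hz)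
    rw [Complex.sub_re, Complex.ofReal_re, abs_lt] at this
    constructor <;> linarith [this.1, this.2]
  -- On (a, b] write L(μ)/(z - μ) = l(z)/(z - μ) minus a divided difference. The far part and the
  -- divided difference are holomorphic near x₀, so the jump sits entirely in the two logarithms.
  have key : ∀ z ∈ Metric.ball (x₀ : ℂ) (s / 2), z.im ≠ 0 → cauchyTransform L z =
      (∫ μ in (Set.Ioc a b)ᶜ, L μ / (z - μ)) - (∫ μ in Set.Ioc a b, dslope l (μ : ℂ) z)
        + l z * (Complex.log (z - a) - Complex.log (z - b)) := by
    intro z hz hzi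
    have hi := integrable_div_sub hL hzi
    rw [cauchyTransform, ← integral_add_compl (measurableSet_Ioc (a := a) (b := b)) hi,
      ← intervalIntegral_inv_sub hzi, intervalIntegral.integral_of_le hab, ← integral_const_mul]
    have hci : IntegrableOn (fun μ : ℝ => l z * (z - μ)⁻¹) (Set.Ioc a b) := by
      refine Continuous.integrableOn_Ioc ?_
      refine continuous_const.mul (Continuous.inv₀ (by fun_prop) (sub_ofReal_ne_zero hzi))
    have heq : ∀ μ ∈ Set.Ioc a b, dslope l (μ : ℂ) z = l z * (z - μ)⁻¹ - L μ / (z - μ) := by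
      intro μ hμ
      have h0 := sub_ofReal_ne_zero hzi μ
      rw [dslope_of_ne _ (sub_ne_zero.1 h0), slope_def_field, hlL μ (hsub2 (hmem μ hμ))]
      field_simp
    rw [setIntegral_congr_fun measurableSet_Ioc heq, integral_sub hci hi.integrableOn]
    ring
  -- The cut of log (z - b) passes through x₀, that of log (b - z) does not. The two differ by +iπ
  -- above the line and by -iπ below it, whence agreement above and the jump -2πi l below.
  refine ⟨s / 2, by positivity, fun z => (∫ μ in (Set.Ioc a b)ᶜ, L μ / (z - μ))
    - (∫ μ in Set.Ioc a b, dslope l (μ : ℂ) z)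
    + l z * (Complex.log (z - a) - Complex.log (b - z) - Real.pi * Complex.I), ?_, ?_, ?_⟩
  · have h1 : DifferentiableOn ℂ (fun z => ∫ μ in (Set.Ioc a b)ᶜ, L μ / (z - μ))
        (Metric.ball (x₀ : ℂ) (s / 2)) := by
      intro z hz
      have hd : 0 < (s / 2 - dist z x₀) / 2 := by linarith [Metric.mem_ball.1 hz]
      refine (differentiableAt_setIntegral_div_sub hL measurableSet_Ioc.compl
        (d := min ((s / 2 - dist z x₀) / 2) (s / 2)) (lt_min hd (by positivity))
        ?_).differentiableWithinAt
      intro μ hμ w hw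
      have h1 : dist w z < (s / 2 - dist z x₀) / 2 := hw.trans_le (min_le_left _ _)
      have h2 : dist w x₀ ≤ s / 2 := by
        linarith [dist_triangle w z x₀, dist_nonneg (x := w) (y := z)]
      have h3 : s ≤ dist (μ : ℂ) x₀ := by
        rw [Complex.dist_eq, ← Complex.ofReal_sub, Complex.norm_real, Real.norm_eq_abs]
        by_contra hcon
        rw [not_le, abs_lt] at hcon
        exact hμ ⟨by linarith [hcon.1], by linarith [hcon.2]⟩
      refine (min_le_right _ _).trans ?_
      rw [← Complex.dist_eq]
      have := dist_triangle (μ : ℂ) w x₀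
      rw [dist_comm (μ : ℂ) w] at this
      linarith
    have h2 := (differentiableOn_integral_dslope hsR hl hmem).mono hsub
    have h3 : DifferentiableOn ℂ (fun z : ℂ => Complex.log (z - a))
        (Metric.ball (x₀ : ℂ) (s / 2)) := fun z hz =>
      ((differentiableAt_id.sub_const _).clog
        (Or.inl (by simpa using (hre z hz).1))).differentiableWithinAt
    have h4 : DifferentiableOn ℂ (fun z : ℂ => Complex.log (b - z))
        (Metric.ball (x₀ : ℂ) (s / 2)) := fun z hz =>
      ((differentiableAt_id.const_sub _).clog
        (Or.inl (by simpa using (hre z hz).2))).differentiableWithinAt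
    exact (h1.sub h2).add ((hl.mono (hsub.trans hsub2)).mul ((h3.sub h4).sub_const _))
  · intro z hz hzi
    have hlog : Complex.log (z - b) = Complex.log (b - z) + Real.pi * Complex.I := by
      rw [← neg_sub]
      exact log_neg_of_im_neg (by simpa using hzi)
    rw [key z hz hzi.ne', hlog]
    ring
  · intro z hz hzi
    have hlog : Complex.log (z - b) = Complex.log (b - z) - Real.pi * Complex.I := by
      rw [← neg_sub]
      exact log_neg_of_im_pos (by simpa using hzi)
    rw [key z hz hzi.ne, hlog]
    ring

/-! ### Gluing across a line and extension by a functional equation. -/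

/-- Two holomorphic functions on the two sides of a horizontal line are glued together if this is
possible locally. -/
theorem exists_differentiableOn_glue {a h : ℝ} {f₁ f₂ : ℂ → ℂ}
    (h₁ : DifferentiableOn ℂ f₁ {z | a < z.im})
    (h₂ : DifferentiableOn ℂ f₂ {z | a - h < z.im ∧ z.im < a})
    (hloc : ∀ p : ℂ, p.im = a → ∃ r > 0, ∃ g : ℂ → ℂ, DifferentiableOn ℂ g (Metric.ball p r) ∧
      (∀ z ∈ Metric.ball p r, a < z.im → g z = f₁ z) ∧
      ∀ z ∈ Metric.ball p r, z.im < a → g z = f₂ z) :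
    ∃ H : ℂ → ℂ, DifferentiableOn ℂ H {z | a - h < z.im} ∧ (∀ z, a < z.im → H z = f₁ z) ∧
      ∀ z, z.im < a → H z = f₂ z := by
  classical
  have hup : IsOpen {z : ℂ | a < z.im} := isOpen_lt continuous_const Complex.continuous_im
  have hdn : IsOpen {z : ℂ | a - h < z.im ∧ z.im < a} :=
    (isOpen_lt continuous_const Complex.continuous_im).inter
      (isOpen_lt Complex.continuous_im continuous_const)
  -- On the line itself the value is the limit from above; the local continuations show that it
  -- exists and is the right one.
  set H : ℂ → ℂ := fun z => if a < z.im then f₁ z else if z.im < a then f₂ z else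
    limUnder (𝓝[{z | a < z.im}] z) f₁ with hH
  have H1 : ∀ z, a < z.im → H z = f₁ z := fun z hz => by simp [hH, hz]
  have H2 : ∀ z, z.im < a → H z = f₂ z := fun z hz => by simp [hH, hz, hz.not_gt]
  refine ⟨H, ?_, H1, H2⟩
  intro z hz
  refine DifferentiableAt.differentiableWithinAt ?_
  rcases lt_trichotomy z.im a with hlt | heq | hgt
  · refine (h₂.differentiableAt (hdn.mem_nhds ⟨hz, hlt⟩)).congr_of_eventuallyEq ?_
    filter_upwards [hdn.mem_nhds ⟨hz, hlt⟩] with w hw using H2 w hw.2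
  · obtain ⟨r, hr, g, hg, hg1, hg2⟩ := hloc z heq
    refine (hg.differentiableAt (Metric.ball_mem_nhds z hr)).congr_of_eventuallyEq ?_
    filter_upwards [Metric.ball_mem_nhds z hr] with w hw
    rcases lt_trichotomy w.im a with hlt | heq | hgt
    · rw [H2 w hlt, hg2 w hw hlt]
    · have hne : (𝓝[{z | a < z.im}] w).NeBot := by
        rw [← mem_closure_iff_nhdsWithin_neBot, Complex.closure_setOfPred_lt_im]
        exact heq.ge
      have hlim : Tendsto f₁ (𝓝[{z | a < z.im}] w) (𝓝 (g w)) := by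
        refine Tendsto.congr' ?_ (((hg.differentiableAt
          (Metric.isOpen_ball.mem_nhds hw)).continuousAt.tendsto).mono_left nhdsWithin_le_nhds)
        filter_upwards [nhdsWithin_le_nhds (Metric.isOpen_ball.mem_nhds hw), self_mem_nhdsWithin]
          with v hv hv' using hg1 v hv hv'
      simp [hH, heq, hlim.limUnder_eq]
    · rw [H1 w hgt, hg1 w hw hgt]
  · refine (h₁.differentiableAt (hup.mem_nhds hgt)).congr_of_eventuallyEq ?_
    filter_upwards [hup.mem_nhds hgt] with w hw using H1 w hw

/-- A holomorphic function satisfying `H(z) = p(z) + q(z) H(z + ih)` extends downwards. -/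
theorem exists_entire_extension {a h : ℝ} (hh : 0 < h) {H p q : ℂ → ℂ}
    (hp : DifferentiableOn ℂ p {z | z.im < a}) (hq : DifferentiableOn ℂ q {z | z.im < a})
    (hH : DifferentiableOn ℂ H {z | a - h < z.im})
    (hrec : ∀ z : ℂ, a - h < z.im → z.im < a → H z = p z + q z * H (z + h * Complex.I)) :
    ∃ E : ℂ → ℂ, Differentiable ℂ E ∧ ∀ z, a - h < z.im → E z = H z := by
  classical
  have hdn : IsOpen {z : ℂ | z.im < a} := isOpen_lt Complex.continuous_im continuous_const
  have hup : ∀ c : ℝ, IsOpen {z : ℂ | c < z.im} := fun c =>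
    isOpen_lt continuous_const Complex.continuous_im
  have him : ∀ z : ℂ, (z + h * Complex.I).im = z.im + h := fun z => by simp
  -- `S n` is the extension to Im z > a - h - n h; each use of the relation gains one strip of
  -- height h.
  obtain ⟨S, S0, Ss⟩ : ∃ S : ℕ → ℂ → ℂ, S 0 = H ∧ ∀ n z, S (n + 1) z =
      if a - h < z.im then H z else p z + q z * S n (z + h * Complex.I) :=
    ⟨fun n => Nat.rec H (fun _ f z =>
      if a - h < z.im then H z else p z + q z * f (z + h * Complex.I)) n, rfl, fun _ _ => rfl⟩
  have Stop : ∀ n z, a - h < z.im → S n z = H z := by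
    rintro (_ | n) z hz
    · rw [S0]
    · rw [Ss, if_pos hz]
  have Sstep : ∀ n : ℕ, ∀ z : ℂ, a - h - n * h < z.im → S (n + 1) z = S n z := by
    intro n
    induction n with
    | zero =>
      intro z hz
      have : a - h < z.im := by simpa using hz
      rw [Stop _ _ this, Stop _ _ this]
    | succ n ih =>
      intro z hz
      by_cases hc : a - h < z.im
      · rw [Stop _ _ hc, Stop _ _ hc]
      · rw [Ss, if_neg hc, Ss n z, if_neg hc, ih _ (by rw [him]; push_cast at hz; linarith)]
  have Srec : ∀ n z, z.im < a → S (n + 1) z = p z + q z * S n (z + h * Complex.I) := by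
    intro n z hz
    rw [Ss]
    split_ifs with hc
    · rw [hrec z hc hz, Stop n _ (by rw [him]; linarith)]
    · rfl
  have Sdiff : ∀ n : ℕ, DifferentiableOn ℂ (S n) {z | a - h - n * h < z.im} := by
    intro n
    induction n with
    | zero => simpa [S0] using hH
    | succ n ih =>
      intro z hz
      refine DifferentiableAt.differentiableWithinAt ?_
      by_cases hc : a - h < z.im
      · refine (hH.differentiableAt ((hup _).mem_nhds hc)).congr_of_eventuallyEq ?_
        filter_upwards [(hup _).mem_nhds hc] with w hw using Stop _ w hw
      · have hza : z.im < a := by linarith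
        have hd : DifferentiableAt ℂ (fun z => p z + q z * S n (z + h * Complex.I)) z := by
          refine (hp.differentiableAt (hdn.mem_nhds hza)).add
            ((hq.differentiableAt (hdn.mem_nhds hza)).mul ?_)
          refine DifferentiableAt.comp z (g := S n) ?_ (by fun_prop)
          refine ih.differentiableAt ((hup _).mem_nhds ?_)
          rw [mem_ofPred_eq] at hz
          rw [mem_ofPred_eq, him]; push_cast at hz; linarith
        refine hd.congr_of_eventuallyEq ?_
        filter_upwards [hdn.mem_nhds hza] with w hw using Srec n w hw
  have Smono : ∀ n m : ℕ, n ≤ m → ∀ z : ℂ, a - h - n * h < z.im → S m z = S n z := by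
    intro n m hnm
    induction m, hnm using Nat.le_induction with
    | base => intros; rfl
    | succ m hm ih =>
      intro z hz
      have hm' : (n : ℝ) ≤ m := by exact_mod_cast hm
      rw [Sstep m z (by nlinarith), ih z hz]
  have hex : ∀ z : ℂ, ∃ n : ℕ, a - h - n * h < z.im := by
    intro z
    obtain ⟨n, hn⟩ := exists_nat_gt ((a - h - z.im) / h)
    exact ⟨n, by rw [div_lt_iff₀ hh] at hn; linarith⟩
  choose ν hν using hex
  have hE : ∀ (n : ℕ) (z : ℂ), a - h - n * h < z.im → S (ν z) z = S n z := by
    intro n z hz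
    rcases le_total n (ν z) with hle | hle
    · exact Smono _ _ hle z hz
    · exact (Smono _ _ hle z (hν z)).symm
  refine ⟨fun z => S (ν z) z, fun z => ?_, fun z hz => Stop _ z hz⟩
  refine ((Sdiff (ν z)).differentiableAt ((hup _).mem_nhds (hν z))).congr_of_eventuallyEq ?_
  filter_upwards [(hup _).mem_nhds (hν z)] with w hw using hE _ w hw

/-! ### Stirling-type bounds for the Gamma function. -/

theorem norm_Gamma_le_Gamma_re {s : ℂ} (hs : 0 < s.re) :
    ‖Complex.Gamma s‖ ≤ Real.Gamma s.re := by
  rw [Complex.Gamma_eq_integral hs, Real.Gamma_eq_integral hs, Complex.GammaIntegral]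
  refine (norm_integral_le_integral_norm _).trans_eq (setIntegral_congr_fun measurableSet_Ioi ?_)
  intro x hx
  simp only
  rw [norm_mul, Complex.norm_cpow_eq_rpow_re_of_pos hx, Complex.norm_real, Real.norm_eq_abs,
    Real.abs_exp]
  simp

/-- On the critical line the reflection formula reads |Γ(s)|² cosh(π Im s) = π, and e^x ≤ 2 cosh x
leaves the square at most 2π < 9. -/
theorem norm_Gamma_mul_exp_le_of_re_eq_half {s : ℂ} (hs : s.re = 1 / 2) :
    ‖Complex.Gamma s‖ * Real.exp (Real.pi / 2 * |s.im|) ≤ 3 := by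
  have hconj : 1 - s = (starRingEnd ℂ) s := by
    apply Complex.ext <;> simp [hs]; norm_num
  have hsin : Complex.sin (Real.pi * s) = (Real.cosh (Real.pi * s.im) : ℂ) := by
    have : (Real.pi : ℂ) * s = Real.pi / 2 - -((Real.pi * s.im : ℝ) : ℂ) * Complex.I := by
      apply Complex.ext <;> simp [hs]; ring
    rw [this, Complex.sin_pi_div_two_sub, Complex.cos_mul_I, Complex.cosh_neg, Complex.ofReal_cosh]
  have h1 := congrArg norm (Complex.Gamma_mul_Gamma_one_sub s)
  rw [hconj, Complex.Gamma_conj, norm_mul, RCLike.norm_conj, hsin, norm_div, Complex.norm_real,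
    Complex.norm_real, Real.norm_of_nonneg Real.pi_pos.le,
    Real.norm_of_nonneg (Real.cosh_pos _).le, eq_div_iff (Real.cosh_pos _).ne'] at h1
  have h2 : Real.exp (Real.pi * |s.im|) ≤ 2 * Real.cosh (Real.pi * s.im) := by
    rw [← Real.cosh_abs, abs_mul, abs_of_pos Real.pi_pos, Real.cosh_eq]
    linarith [Real.exp_pos (-(Real.pi * |s.im|))]
  have h3 : Real.exp (Real.pi / 2 * |s.im|) * Real.exp (Real.pi / 2 * |s.im|) =
      Real.exp (Real.pi * |s.im|) := by
    rw [← Real.exp_add]; ring_nf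
  refine abs_le_of_sq_le_sq' ?_ (by norm_num) |>.2
  have h4 : (‖Complex.Gamma s‖ * Real.exp (Real.pi / 2 * |s.im|)) ^ 2 =
      ‖Complex.Gamma s‖ * ‖Complex.Gamma s‖ * Real.exp (Real.pi * |s.im|) := by rw [← h3]; ring
  rw [h4]
  have h5 := mul_le_mul_of_nonneg_left h2 (mul_self_nonneg ‖Complex.Gamma s‖)
  nlinarith [Real.pi_lt_d2]

theorem im_mul_arg_le {s : ℂ} (hs : 0 ≤ s.re) : s.im * s.arg ≤ Real.pi / 2 * |s.im| := by
  have h := Complex.abs_arg_le_pi_div_two_iff.2 hs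
  calc s.im * s.arg ≤ |s.im * s.arg| := le_abs_self _
    _ = |s.arg| * |s.im| := by rw [abs_mul, mul_comm]
    _ ≤ _ := by gcongr

theorem pi_div_two_sub_mul_sin_le_cos {x : ℝ} (h0 : 0 ≤ x) (h1 : x < Real.pi / 2) :
    (Real.pi / 2 - x) * Real.sin x ≤ Real.cos x := by
  rcases h0.eq_or_lt with rfl | hx
  · simp
  · have h := Real.le_tan (x := Real.pi / 2 - x) (by linarith) (by linarith)
    rwa [Real.tan_pi_div_two_sub, Real.tan_eq_sin_div_cos, inv_div,
      le_div_iff₀ (Real.sin_pos_of_pos_of_lt_pi hx (by linarith))] at h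

/-- With θ = |arg s|, multiply (π/2 - θ) sin θ ≤ cos θ by |s|. Together with `im_mul_arg_le` this
replaces Im s · arg s by π/2 |Im s| up to a bounded error in a strip. -/
theorem le_im_mul_arg {s : ℂ} (hs : 0 < s.re) :
    Real.pi / 2 * |s.im| - s.re ≤ s.im * s.arg := by
  have hlt := abs_lt.1 (Complex.abs_arg_lt_pi_div_two_iff.2 (Or.inl hs))
  have him := Complex.norm_mul_sin_arg s
  have hre := Complex.norm_mul_cos_arg s
  have hn := norm_nonneg s
  rcases le_total 0 s.arg with h | h
  · have h1 := mul_le_mul_of_nonneg_left (pi_div_two_sub_mul_sin_le_cos h hlt.2) hn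
    rw [abs_of_nonneg (Complex.arg_nonneg_iff.1 h)]
    linear_combination h1 - (Real.pi / 2 - s.arg) * him + hre
  · have h1 := mul_le_mul_of_nonneg_left
      (pi_div_two_sub_mul_sin_le_cos (x := -s.arg) (by linarith) (by linarith [hlt.1])) hn
    rw [Real.sin_neg, Real.cos_neg] at h1
    have h2 : s.im ≤ 0 := by
      rw [← him]
      exact mul_nonpos_of_nonneg_of_nonpos hn
        (Real.sin_nonpos_of_nonpos_of_neg_pi_le h (by linarith [hlt.1, Real.pi_pos]))
    rw [abs_of_nonpos h2]
    linear_combination h1 + (Real.pi / 2 + s.arg) * him + hre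

theorem norm_exp_half_sub_mul_log {s : ℂ} (hs : s ≠ 0) :
    ‖Complex.exp ((1 / 2 - s) * Complex.log s)‖ =
      ‖s‖ ^ (1 / 2 - s.re) * Real.exp (s.im * s.arg) := by
  rw [Complex.norm_exp, Real.rpow_def_of_pos (norm_pos_iff.2 hs), ← Real.exp_add]
  congr 1
  simp [Complex.mul_re, Complex.log_re, Complex.log_im]
  ring

/-- Dividing Γ(s) by its Stirling factor s^(s - 1/2) gives a function bounded on both edges of the
strip, hence inside it by Phragmén–Lindelöf. The edge 7/2 reduces to the edge 1/2 by three uses of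
Γ(s + 1) = s Γ(s). -/
theorem norm_Gamma_mul_exp_le {s : ℂ} (h1 : 1 / 2 ≤ s.re) (h2 : s.re ≤ 7 / 2) :
    ‖Complex.Gamma s * Complex.exp ((1 / 2 - s) * Complex.log s)‖ ≤ 3 := by
  have hpos : ∀ z : ℂ, 1 / 2 ≤ z.re → 0 < z.re := fun z hz => by linarith
  have hne : ∀ z : ℂ, 1 / 2 ≤ z.re → z ≠ 0 := fun z hz h => by
    have := hpos z hz; simp [h] at this
  have hcl : closure (Complex.re ⁻¹' Ioo (1 / 2 : ℝ) (7 / 2)) ⊆ {z | 1 / 2 ≤ z.re} :=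
    closure_minimal (fun z hz => hz.1.le) (isClosed_le continuous_const Complex.continuous_re)
  have hbase : ∀ z : ℂ, z.re = 1 / 2 →
      ‖Complex.Gamma z * Complex.exp ((1 / 2 - z) * Complex.log z)‖ ≤ 3 := by
    intro z hz
    rw [norm_mul, norm_exp_half_sub_mul_log (hne z hz.ge), hz, sub_self, Real.rpow_zero, one_mul]
    refine le_trans ?_ (norm_Gamma_mul_exp_le_of_re_eq_half hz)
    exact mul_le_mul_of_nonneg_left
      (Real.exp_le_exp.2 (im_mul_arg_le (by rw [hz]; norm_num))) (norm_nonneg _)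
  refine PhragmenLindelof.vertical_strip (a := 1 / 2) (b := 7 / 2)
    (f := fun z => Complex.Gamma z * Complex.exp ((1 / 2 - z) * Complex.log z)) ?_ ?_ hbase ?_ h1 h2
  · refine DifferentiableOn.diffContOnCl fun z hz => ?_
    have hz' : 0 < z.re := hpos z (hcl hz)
    have hG : DifferentiableAt ℂ Complex.Gamma z := by
      refine Complex.differentiableAt_Gamma _ fun m hm => ?_
      rw [hm] at hz'
      simp at hz'
      linarith [(Nat.cast_nonneg m : (0 : ℝ) ≤ m)]
    have hlog : DifferentiableAt ℂ Complex.log z :=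
      Complex.differentiableAt_log (Or.inl hz')
    exact (hG.mul (((differentiableAt_const _).sub differentiableAt_id).mul
      hlog).cexp).differentiableWithinAt
  · refine ⟨1, by rw [lt_div_iff₀ (by norm_num)]; linarith [Real.pi_gt_three], Real.pi / 2, ?_⟩
    have hcont : ContinuousOn Real.Gamma (Icc (1 / 2) (7 / 2)) := fun x hx =>
      (Real.differentiableAt_Gamma (fun m hm => by
        have := hx.1
        linarith [(Nat.cast_nonneg m : (0 : ℝ) ≤ m)])).continuousAt.continuousWithinAt
    obtain ⟨M, hM⟩ := isCompact_Icc.exists_bound_of_continuousOn hcont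
    refine Asymptotics.IsBigO.of_bound (M * 8) (Filter.mem_inf_of_right ?_)
    intro z hz
    rw [mem_preimage] at hz
    have hz1 : 1 / 2 ≤ z.re := hz.1.le
    have hzn : (1 / 2 : ℝ) ≤ ‖z‖ := hz1.trans ((le_abs_self _).trans (Complex.abs_re_le_norm z))
    rw [mem_ofPred_eq, norm_mul, norm_exp_half_sub_mul_log (hne z hz1),
      Real.norm_of_nonneg (Real.exp_pos _).le, ← mul_assoc]
    have hM' := hM z.re ⟨hz1, hz.2.le⟩
    have hM0 : 0 ≤ M := (norm_nonneg _).trans hM'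
    have ha : ‖Complex.Gamma z‖ ≤ M :=
      (norm_Gamma_le_Gamma_re (hpos z hz1)).trans ((le_abs_self _).trans hM')
    have hb : ‖z‖ ^ (1 / 2 - z.re) ≤ 8 := by
      calc ‖z‖ ^ (1 / 2 - z.re) ≤ (1 / 2 : ℝ) ^ (1 / 2 - z.re) :=
            Real.rpow_le_rpow_of_nonpos (by norm_num) hzn (by linarith)
        _ ≤ (1 / 2 : ℝ) ^ (-3 : ℝ) :=
            Real.rpow_le_rpow_of_exponent_ge (by norm_num) (by norm_num) (by linarith [hz.2])
        _ = 8 := by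
            rw [Real.rpow_neg (by norm_num), show (3 : ℝ) = (3 : ℕ) by norm_num, Real.rpow_natCast]
            norm_num
    have hc : Real.exp (z.im * z.arg) ≤ Real.exp (Real.pi / 2 * Real.exp (1 * |z.im|)) := by
      apply Real.exp_le_exp.2
      refine (im_mul_arg_le (hpos z hz1).le).trans ?_
      have := Real.add_one_le_exp (1 * |z.im|)
      have hpi := Real.pi_pos
      gcongr
      linarith
    gcongr
  · intro z hz
    have hs0 : (z - 3).re = 1 / 2 := by simp [hz]; norm_num
    have e0 : z - 3 ≠ 0 := hne _ hs0.ge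
    have e1 : z - 2 ≠ 0 := hne _ (by simp [hz]; norm_num)
    have e2 : z - 1 ≠ 0 := hne _ (by simp [hz]; norm_num)
    have hG : Complex.Gamma z = (z - 1) * ((z - 2) * ((z - 3) * Complex.Gamma (z - 3))) := by
      rw [← Complex.Gamma_add_one _ e0, show z - 3 + 1 = z - 2 by ring,
        ← Complex.Gamma_add_one _ e1, show z - 2 + 1 = z - 1 by ring,
        ← Complex.Gamma_add_one _ e2, sub_add_cancel]
    -- The point c is at least as close to z as the origin exactly when c ≤ 2 Re z = 7 (for c > 0).
    have hle : ∀ c : ℝ, 0 ≤ c → c ≤ 7 → ‖z - c‖ ≤ ‖z‖ := by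
      intro c hc hc7
      rw [← abs_norm, ← abs_norm z, ← sq_le_sq, Complex.sq_norm, Complex.sq_norm,
        Complex.normSq_apply, Complex.normSq_apply]
      simp [hz]
      nlinarith
    have hz0 : z ≠ 0 := hne z (by rw [hz]; norm_num)
    have hzp : 0 < ‖z‖ := norm_pos_iff.2 hz0
    rw [norm_mul, norm_exp_half_sub_mul_log hz0, hG, hz, norm_mul, norm_mul, norm_mul]
    have hp : ‖z‖ ^ ((1 / 2 : ℝ) - 7 / 2) = (‖z‖ ^ 3)⁻¹ := by
      rw [show (1 / 2 : ℝ) - 7 / 2 = -((3 : ℕ) : ℝ) by norm_num, Real.rpow_neg hzp.le,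
        Real.rpow_natCast]
    rw [hp]
    have l1 : ‖z - 1‖ ≤ ‖z‖ := by simpa using hle 1 (by norm_num) (by norm_num)
    have l2 : ‖z - 2‖ ≤ ‖z‖ := by simpa using hle 2 (by norm_num) (by norm_num)
    have l3 : ‖z - 3‖ ≤ ‖z‖ := by simpa using hle 3 (by norm_num) (by norm_num)
    have hb := norm_Gamma_mul_exp_le_of_re_eq_half hs0
    have him : (z - 3).im = z.im := by simp
    rw [him] at hb
    calc ‖z - 1‖ * (‖z - 2‖ * (‖z - 3‖ * ‖Complex.Gamma (z - 3)‖)) *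
          ((‖z‖ ^ 3)⁻¹ * Real.exp (z.im * z.arg))
        ≤ ‖z‖ * (‖z‖ * (‖z‖ * ‖Complex.Gamma (z - 3)‖)) *
          ((‖z‖ ^ 3)⁻¹ * Real.exp (Real.pi / 2 * |z.im|)) := by
          have := Real.exp_le_exp.2 (im_mul_arg_le (s := z) (by rw [hz]; norm_num))
          gcongr
      _ = ‖Complex.Gamma (z - 3)‖ * Real.exp (Real.pi / 2 * |z.im|) := by
          field_simp
      _ ≤ 3 := hb

theorem norm_Gamma_le {s : ℂ} (h1 : 1 / 2 ≤ s.re) (h2 : s.re ≤ 7 / 2) :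
    ‖Complex.Gamma s‖ ≤
      3 * Real.exp (7 / 2) * ‖s‖ ^ (s.re - 1 / 2) * Real.exp (-(Real.pi / 2 * |s.im|)) := by
  have hs0 : s ≠ 0 := by rintro rfl; norm_num at h1
  have hsp : 0 < ‖s‖ := norm_pos_iff.2 hs0
  have h := norm_Gamma_mul_exp_le h1 h2
  rw [norm_mul, norm_exp_half_sub_mul_log hs0, ← le_div_iff₀ (by positivity)] at h
  refine h.trans ?_
  rw [div_le_iff₀ (by positivity)]
  have hb : ‖s‖ ^ (s.re - 1 / 2) * ‖s‖ ^ (1 / 2 - s.re) = 1 := by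
    rw [← Real.rpow_add hsp]; simp
  -- The factor e^(7/2) absorbs the error Re s ≤ 7/2 of `le_im_mul_arg`.
  have ha : 1 ≤ Real.exp (7 / 2) * Real.exp (-(Real.pi / 2 * |s.im|)) *
      Real.exp (s.im * s.arg) := by
    rw [← Real.exp_add, ← Real.exp_add]
    apply Real.one_le_exp
    linarith [le_im_mul_arg (s := s) (by linarith)]
  calc (3 : ℝ) ≤ 3 * (Real.exp (7 / 2) * Real.exp (-(Real.pi / 2 * |s.im|)) *
      Real.exp (s.im * s.arg)) * (‖s‖ ^ (s.re - 1 / 2) * ‖s‖ ^ (1 / 2 - s.re)) := by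
        rw [hb]; linarith
    _ = _ := by ring

theorem norm_sin_le (w : ℂ) : ‖Complex.sin w‖ ≤ Real.exp |w.im| := by
  rw [Complex.sin, norm_div, norm_mul, Complex.norm_I, mul_one, RCLike.norm_ofNat,
    div_le_iff₀ (by norm_num)]
  refine (norm_sub_le _ _).trans ?_
  rw [Complex.norm_exp, Complex.norm_exp]
  have e1 : (-w * Complex.I).re = w.im := by simp
  have e2 : (w * Complex.I).re = -w.im := by simp
  rw [e1, e2]
  linarith [Real.exp_le_exp.2 (le_abs_self w.im), Real.exp_le_exp.2 (neg_le_abs w.im)]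

/-- The Stirling-type bound for the reciprocal Gamma function in a vertical strip. -/
theorem exists_norm_Gamma_inv_le : ∃ C > 0, ∀ w : ℂ, 0 ≤ w.re → w.re ≤ 2 → 1 ≤ |w.im| →
    ‖(Complex.Gamma w)⁻¹‖ ≤ C * |w.im| ^ (1 / 2 - w.re) * Real.exp (Real.pi / 2 * |w.im|) := by
  -- The power of 4 comes from |3 - w| ≤ 3 + |Im w| ≤ 4|Im w|, raised to an exponent at most 5/2.
  refine ⟨3 * Real.exp (7 / 2) * 4 ^ (5 / 2 : ℝ), by positivity, fun w h0 h2 him => ?_⟩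
  have hpi := Real.pi_pos
  have htp : 0 < |w.im| := by linarith
  have hti : w.im ≠ 0 := abs_pos.1 htp
  have hsub : ∀ c : ℝ, |w.im| ≤ ‖(c : ℂ) - w‖ := fun c => by
    simpa using Complex.abs_im_le_norm ((c : ℂ) - w)
  have n1 : (1 : ℂ) - w ≠ 0 := by
    have := hsub 1
    rw [Complex.ofReal_one] at this
    exact norm_pos_iff.1 (htp.trans_le this)
  have n2 : (2 : ℂ) - w ≠ 0 := by
    have := hsub 2
    rw [Complex.ofReal_ofNat] at this
    exact norm_pos_iff.1 (htp.trans_le this)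
  have hG : Complex.Gamma (3 - w) = (2 - w) * ((1 - w) * Complex.Gamma (1 - w)) := by
    rw [← Complex.Gamma_add_one _ n1, show (1 : ℂ) - w + 1 = 2 - w by ring,
      ← Complex.Gamma_add_one _ n2]
    congr 1; ring
  have hsin : Complex.sin (Real.pi * w) ≠ 0 := by
    rw [Complex.sin_ne_zero_iff]
    intro k hk
    apply hti
    have h := congrArg Complex.im hk
    simpa [hpi.ne'] using h
  have hrefl := Complex.Gamma_mul_Gamma_one_sub w
  have hGw : Complex.Gamma w ≠ 0 := by
    intro h
    rw [h, zero_mul, eq_comm, div_eq_zero_iff] at hrefl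
    simp [hpi.ne', hsin] at hrefl
  -- Reflection is shifted from 1 - w to 3 - w, whose real part lies in [1, 3], inside the range of
  -- `norm_Gamma_le`; the two extra factors cost |Im w|².
  have hinv : (Complex.Gamma w)⁻¹ =
      Complex.Gamma (3 - w) * Complex.sin (Real.pi * w) / (Real.pi * ((2 - w) * (1 - w))) := by
    have hpc : (Real.pi : ℂ) ≠ 0 := by exact_mod_cast hpi.ne'
    rw [eq_div_iff hsin] at hrefl
    rw [inv_eq_iff_eq_inv, inv_div, eq_div_iff (mul_ne_zero _ hsin), hG]
    · linear_combination (2 - w) * (1 - w) * hrefl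
    · rw [hG]
      refine mul_ne_zero n2 (mul_ne_zero n1 fun h => ?_)
      rw [h, mul_zero, zero_mul] at hrefl
      exact hpc hrefl.symm
  have hre : (3 - w).re = 3 - w.re := by simp
  have himm : |(3 - w).im| = |w.im| := by simp
  have hb := norm_Gamma_le (s := 3 - w) (by rw [hre]; linarith) (by rw [hre]; linarith)
  rw [hre, himm] at hb
  have hs : ‖Complex.sin (Real.pi * w)‖ ≤ Real.exp (Real.pi * |w.im|) := by
    refine (norm_sin_le _).trans_eq ?_
    simp [abs_mul, abs_of_pos hpi]
  have hn3 : ‖3 - w‖ ≤ 4 * |w.im| := by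
    refine (Complex.norm_le_abs_re_add_abs_im _).trans ?_
    rw [himm, hre, abs_of_nonneg (by linarith)]
    linarith
  have hp3 : ‖3 - w‖ ^ (3 - w.re - 1 / 2) ≤ 4 ^ (5 / 2 : ℝ) * |w.im| ^ (3 - w.re - 1 / 2) := by
    calc ‖3 - w‖ ^ (3 - w.re - 1 / 2) ≤ (4 * |w.im|) ^ (3 - w.re - 1 / 2) :=
          Real.rpow_le_rpow (norm_nonneg _) hn3 (by linarith)
      _ = 4 ^ (3 - w.re - 1 / 2) * |w.im| ^ (3 - w.re - 1 / 2) :=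
          Real.mul_rpow (by norm_num) htp.le
      _ ≤ _ := by
          gcongr
          · norm_num
          · linarith
  have hd : 1 * (|w.im| * |w.im|) ≤ ‖(Real.pi : ℂ) * ((2 - w) * (1 - w))‖ := by
    rw [norm_mul, norm_mul, Complex.norm_real, Real.norm_of_nonneg hpi.le]
    have h1 := hsub 1
    have h2 := hsub 2
    rw [Complex.ofReal_one] at h1
    rw [Complex.ofReal_ofNat] at h2
    have := Real.pi_gt_three
    gcongr
    linarith
  rw [hinv, norm_div, norm_mul]
  have hpow : |w.im| ^ (3 - w.re - 1 / 2) = |w.im| ^ (1 / 2 - w.re) * (|w.im| * |w.im|) := by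
    rw [show 3 - w.re - 1 / 2 = (1 / 2 - w.re) + ((2 : ℕ) : ℝ) by push_cast; ring,
      Real.rpow_add htp, Real.rpow_natCast, sq]
  have hexp : Real.exp (-(Real.pi / 2 * |w.im|)) * Real.exp (Real.pi * |w.im|) =
      Real.exp (Real.pi / 2 * |w.im|) := by
    rw [← Real.exp_add]; ring_nf
  calc ‖Complex.Gamma (3 - w)‖ * ‖Complex.sin (Real.pi * w)‖ /
        ‖(Real.pi : ℂ) * ((2 - w) * (1 - w))‖
      ≤ 3 * Real.exp (7 / 2) * (4 ^ (5 / 2 : ℝ) * |w.im| ^ (3 - w.re - 1 / 2)) *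
        Real.exp (-(Real.pi / 2 * |w.im|)) * Real.exp (Real.pi * |w.im|) /
        (1 * (|w.im| * |w.im|)) := by
        gcongr
        refine hb.trans ?_
        gcongr
    _ = 3 * Real.exp (7 / 2) * 4 ^ (5 / 2 : ℝ) * |w.im| ^ (1 / 2 - w.re) *
        (Real.exp (-(Real.pi / 2 * |w.im|)) * Real.exp (Real.pi * |w.im|)) := by
        rw [hpow]; field_simp
    _ = _ := by rw [hexp]

/-! ### The functional equation and the entire extension. -/

/-- The exponential of the Cauchy transform, holomorphic in the half-plane `Im z > -h/2`. -/
noncomputable def cauchyUp (L : ℝ → ℂ) (h : ℝ) (z : ℂ) : ℂ :=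
  Complex.exp (-(1 / (2 * Complex.I * Real.pi) * cauchyTransform L (z + Complex.I * h / 2)))

/-- The exponential of the Cauchy transform, holomorphic in the half-plane `Im z < h/2`. -/
noncomputable def cauchyDown (L : ℝ → ℂ) (h : ℝ) (z : ℂ) : ℂ :=
  Complex.exp (1 / (2 * Complex.I * Real.pi) * cauchyTransform L (z - Complex.I * h / 2))

/-- The product of the reciprocal Gamma functions in `Q⁺`. -/
noncomputable def gammaProd {N : ℕ} (h : ℝ) (δ : Fin N → ℂ) (z : ℂ) : ℂ :=
  ∏ k, (Complex.Gamma (1 - Complex.I * (z - δ k) / h))⁻¹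

theorem im_add_I_mul_half (z : ℂ) (h : ℝ) : (z + Complex.I * h / 2).im = z.im + h / 2 := by
  have : Complex.I * h / 2 = ((h / 2 : ℝ) : ℂ) * Complex.I := by push_cast; ring
  rw [this]; simp

theorem im_sub_I_mul_half (z : ℂ) (h : ℝ) : (z - Complex.I * h / 2).im = z.im - h / 2 := by
  have : Complex.I * h / 2 = ((h / 2 : ℝ) : ℂ) * Complex.I := by push_cast; ring
  rw [this]; simp

theorem differentiableAt_cauchyUp {L : ℝ → ℂ} (hL : Integrable L) {h : ℝ} {z : ℂ}
    (hz : -(h / 2) < z.im) : DifferentiableAt ℂ (cauchyUp L h) z := by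
  have hd : DifferentiableAt ℂ (cauchyTransform L) (z + Complex.I * h / 2) :=
    differentiableAt_cauchyTransform hL (by rw [im_add_I_mul_half]; linarith)
  exact ((hd.comp z (f := fun z => z + Complex.I * h / 2) (by fun_prop)).const_mul _).neg.cexp

theorem differentiableAt_cauchyDown {L : ℝ → ℂ} (hL : Integrable L) {h : ℝ} {z : ℂ}
    (hz : z.im < h / 2) : DifferentiableAt ℂ (cauchyDown L h) z := by
  have hd : DifferentiableAt ℂ (cauchyTransform L) (z - Complex.I * h / 2) :=
    differentiableAt_cauchyTransform hL (by rw [im_sub_I_mul_half]; linarith)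
  exact ((hd.comp z (f := fun z => z - Complex.I * h / 2) (by fun_prop)).const_mul _).cexp

theorem cauchyDown_ne_zero (L : ℝ → ℂ) (h : ℝ) (z : ℂ) : cauchyDown L h z ≠ 0 :=
  Complex.exp_ne_zero _

theorem differentiable_vartheta {N : ℕ} (δ : Fin N → ℂ) : Differentiable ℂ (vartheta δ) := by
  unfold vartheta; fun_prop

theorem vartheta_ne_zero {N : ℕ} {δ : Fin N → ℂ} {h : ℝ} (hδ : ∀ k, |(δ k).im| < h / 2) {z : ℂ}
    (hz : h / 2 ≤ |z.im|) : vartheta δ z ≠ 0 := by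
  refine Finset.prod_ne_zero_iff.2 fun k _ hk => ?_
  rw [sub_eq_zero.1 hk] at hz
  exact (hδ k).not_ge hz

theorem differentiable_gammaProd {N : ℕ} (h : ℝ) (δ : Fin N → ℂ) :
    Differentiable ℂ (gammaProd h δ) := by
  intro z
  unfold gammaProd
  refine DifferentiableAt.fun_finsetProd fun k _ => ?_
  exact (Complex.differentiable_one_div_Gamma _).comp z
    (f := fun z => 1 - Complex.I * (z - δ k) / h) (by fun_prop)

/-- Factorwise this is Γ(s + 1) = s Γ(s). The factor ϑ(z + ih) it produces removes the poles from
the continuation of v↑. -/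
theorem gammaProd_eq_mul_vartheta {N : ℕ} {h : ℝ} (hh : h ≠ 0) (δ : Fin N → ℂ) (z : ℂ) :
    gammaProd h δ z = (-Complex.I / h) ^ N * vartheta δ (z + h * Complex.I) *
      gammaProd h δ (z + h * Complex.I) := by
  have hc : (h : ℂ) ≠ 0 := by exact_mod_cast hh
  have hN : (-Complex.I / h) ^ N = ∏ _k : Fin N, (-Complex.I / (h : ℂ)) := by
    rw [Finset.prod_const, Finset.card_univ, Fintype.card_fin]
  rw [gammaProd, gammaProd, vartheta, hN, ← Finset.prod_mul_distrib, ← Finset.prod_mul_distrib]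
  refine Finset.prod_congr rfl fun k _ => ?_
  have h1 : 1 - Complex.I * (z - δ k) / h = -Complex.I / h * (z + h * Complex.I - δ k) := by
    field_simp
    linear_combination (h : ℂ) * Complex.I_sq
  have h2 : 1 - Complex.I * (z + h * Complex.I - δ k) / h =
      1 - Complex.I * (z - δ k) / h + 1 := by
    field_simp
    linear_combination (-(h : ℂ)) * Complex.I_sq
  rw [h2, ← h1]
  exact Complex.one_div_Gamma_eq_self_mul_one_div_Gamma_add_one _

/-- The function whose logarithm is the density of the Cauchy transform. -/
noncomputable def wronskian {N : ℕ} (L : ℝ → ℂ) (h c : ℝ) (δ : Fin N → ℂ) (z : ℂ) : ℂ :=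
  1 + c * (cauchyUp L h (z + Complex.I * h / 2) * cauchyDown L h (z - Complex.I * h / 2)) /
    (vartheta δ (z - Complex.I * h / 2) * vartheta δ (z + Complex.I * h / 2))

/-- At a real point the value is e^L > 0, so nearby the principal logarithm is holomorphic and
extends L. -/
theorem eventually_wronskian {N : ℕ} {L : ℝ → ℝ} (hL : Integrable L) {h c : ℝ} (hh : 0 < h)
    {δ : Fin N → ℂ} (hδ : ∀ k, |(δ k).im| < h / 2)
    (hW : ∀ x : ℝ, wronskian (fun μ => (L μ : ℂ)) h c δ x = Complex.exp (L x)) (x : ℝ) :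
    ∀ᶠ z in 𝓝 (x : ℂ), DifferentiableAt ℂ (wronskian (fun μ => (L μ : ℂ)) h c δ) z ∧
      wronskian (fun μ => (L μ : ℂ)) h c δ z ∈ Complex.slitPlane ∧
      vartheta δ (z + Complex.I * h / 2) ≠ 0 := by
  have hLc : Integrable fun μ => (L μ : ℂ) := hL.ofReal
  have hv := differentiable_vartheta δ
  have h1 : ∀ᶠ z in 𝓝 (x : ℂ), vartheta δ (z + Complex.I * h / 2) ≠ 0 := by
    refine ContinuousAt.eventually_ne (g := fun z => vartheta δ (z + Complex.I * h / 2))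
      (hv.continuous.comp (by fun_prop)).continuousAt
      (vartheta_ne_zero hδ ?_)
    rw [im_add_I_mul_half, Complex.ofReal_im, zero_add]
    exact le_abs_self _
  have h2 : ∀ᶠ z in 𝓝 (x : ℂ), vartheta δ (z - Complex.I * h / 2) ≠ 0 := by
    refine ContinuousAt.eventually_ne (g := fun z => vartheta δ (z - Complex.I * h / 2))
      (hv.continuous.comp (by fun_prop)).continuousAt
      (vartheta_ne_zero hδ ?_)
    rw [im_sub_I_mul_half, Complex.ofReal_im, zero_sub, abs_neg]
    exact le_abs_self _
  have h3 : ∀ᶠ z in 𝓝 (x : ℂ), z.im < h :=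
    Complex.continuous_im.continuousAt.eventually_lt continuousAt_const (by simpa using hh)
  have h4 : ∀ᶠ z in 𝓝 (x : ℂ), -h < z.im :=
    continuousAt_const.eventually_lt Complex.continuous_im.continuousAt (by simpa using hh)
  have h5 : ∀ᶠ z in 𝓝 (x : ℂ),
      DifferentiableAt ℂ (wronskian (fun μ => (L μ : ℂ)) h c δ) z := by
    filter_upwards [h1, h2, h3, h4] with z h1 h2 h3 h4
    have hA : DifferentiableAt ℂ
        (fun z => cauchyUp (fun μ => (L μ : ℂ)) h (z + Complex.I * h / 2)) z :=
      (differentiableAt_cauchyUp hLc (by rw [im_add_I_mul_half]; linarith)).comp z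
        (f := fun z => z + Complex.I * h / 2) (by fun_prop)
    have hB : DifferentiableAt ℂ
        (fun z => cauchyDown (fun μ => (L μ : ℂ)) h (z - Complex.I * h / 2)) z :=
      (differentiableAt_cauchyDown hLc (by rw [im_sub_I_mul_half]; linarith)).comp z
        (f := fun z => z - Complex.I * h / 2) (by fun_prop)
    have hv1 : DifferentiableAt ℂ (fun z => vartheta δ (z + Complex.I * h / 2)) z :=
      (hv _).comp z (f := fun z => z + Complex.I * h / 2) (by fun_prop)
    have hv2 : DifferentiableAt ℂ (fun z => vartheta δ (z - Complex.I * h / 2)) z :=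
      (hv _).comp z (f := fun z => z - Complex.I * h / 2) (by fun_prop)
    exact (((hA.mul hB).const_mul _).div (hv2.mul hv1) (mul_ne_zero h2 h1)).const_add 1
  have h6 : ∀ᶠ z in 𝓝 (x : ℂ), wronskian (fun μ => (L μ : ℂ)) h c δ z ∈ Complex.slitPlane := by
    refine h5.self_of_nhds.continuousAt.eventually_mem (Complex.isOpen_slitPlane.mem_nhds ?_)
    rw [hW, ← Complex.ofReal_exp]
    exact Complex.ofReal_mem_slitPlane.2 (Real.exp_pos _)
  filter_upwards [h1, h5, h6] with z h1 h5 h6 using ⟨h5, h6, h1⟩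

/-- If `1 + c v↑ v↓ / (ϑ ϑ)` is the exponential of the density, then `v↑ / ∏ Γ` is entire. -/
theorem exists_entire_cauchyUp_mul_gammaProd {N : ℕ} {L : ℝ → ℝ} (hL : Integrable L) {h c : ℝ}
    (hh : 0 < h) {δ : Fin N → ℂ} (hδ : ∀ k, |(δ k).im| < h / 2)
    (hW : ∀ x : ℝ, wronskian (fun μ => (L μ : ℂ)) h c δ x = Complex.exp (L x)) :
    ∃ E : ℂ → ℂ, Differentiable ℂ E ∧ ∀ z : ℂ, -(h / 2) < z.im →
      E z = cauchyUp (fun μ => (L μ : ℂ)) h z * gammaProd h δ z := by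
  have hLc : Integrable fun μ => (L μ : ℂ) := hL.ofReal
  set A := cauchyUp (fun μ => (L μ : ℂ)) h with hA
  set B := cauchyDown (fun μ => (L μ : ℂ)) h with hB
  set G := gammaProd h δ with hG
  set a : ℝ := -(h / 2) with ha
  have him : ∀ z : ℂ, (z + h * Complex.I).im = z.im + h := fun z => by simp
  have hGd : Differentiable ℂ G := differentiable_gammaProd h δ
  have hBd : ∀ z : ℂ, z.im < h / 2 → DifferentiableAt ℂ B z := fun z hz =>
    differentiableAt_cauchyDown hLc hz
  have hBd' : ∀ z : ℂ, z.im < a → DifferentiableAt ℂ (fun z => B (z + h * Complex.I)) z :=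
    fun z hz => (hBd _ (by rw [him]; linarith)).comp z (f := fun z => z + h * Complex.I)
      (by fun_prop)
  -- The two terms of W(z + ih/2) G(z)/B(z + ih), after ϑ(z + ih) has been cancelled through the
  -- shift relation for G.
  set p : ℂ → ℂ := fun z => G z / B (z + h * Complex.I) with hp
  set q : ℂ → ℂ := fun z => c * (-Complex.I / h) ^ N * B z /
    (vartheta δ z * B (z + h * Complex.I)) with hq
  have hpd : DifferentiableOn ℂ p {z | z.im < a} := fun z hz =>
    ((hGd z).div (hBd' z hz) (cauchyDown_ne_zero _ _ _)).differentiableWithinAt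
  have hqd : DifferentiableOn ℂ q {z | z.im < a} := by
    intro z hz
    have hz' : z.im < a := hz
    refine DifferentiableAt.differentiableWithinAt ?_
    refine ((hBd z (by linarith)).const_mul _).div ((differentiable_vartheta δ z).mul
      (hBd' z hz)) (mul_ne_zero (vartheta_ne_zero hδ ?_) (cauchyDown_ne_zero _ _ _))
    exact le_trans (by linarith) (neg_le_abs z.im)
  have hf₁ : DifferentiableOn ℂ (fun z => A z * G z) {z | a < z.im} := fun z hz =>
    ((differentiableAt_cauchyUp hLc hz).mul (hGd z)).differentiableWithinAt
  have hf₂ : DifferentiableOn ℂ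
      (fun z => p z + q z * (A (z + h * Complex.I) * G (z + h * Complex.I)))
      {z | a - h < z.im ∧ z.im < a} := by
    intro z hz
    have hA' : DifferentiableAt ℂ (fun z => A (z + h * Complex.I)) z :=
      (differentiableAt_cauchyUp hLc (by rw [him]; linarith [hz.1])).comp z
        (f := fun z => z + h * Complex.I) (by fun_prop)
    have hG' : DifferentiableAt ℂ (fun z => G (z + h * Complex.I)) z :=
      (hGd _).comp z (f := fun z => z + h * Complex.I) (by fun_prop)
    have hz2 : {z : ℂ | a - h < z.im ∧ z.im < a} ⊆ {z | z.im < a} := fun w hw => hw.2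
    exact (hpd.mono hz2 z hz).add ((hqd.mono hz2 z hz).mul
      (hA'.mul hG').differentiableWithinAt)
  obtain ⟨H, hHd, hH1, hH2⟩ := exists_differentiableOn_glue (h := h) hf₁ hf₂ (by
    intro w hw
    set x := w.re with hx
    have hwx : w + Complex.I * h / 2 = x := by
      apply Complex.ext
      · have : Complex.I * h / 2 = ((h / 2 : ℝ) : ℂ) * Complex.I := by push_cast; ring
        rw [this]; simp [hx]
      · rw [im_add_I_mul_half, hw, ha]; simp
    obtain ⟨R, hR, hball⟩ := Metric.eventually_nhds_iff_ball.1
      (eventually_wronskian hL hh hδ hW x)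
    set l : ℂ → ℂ := fun z => Complex.log (wronskian (fun μ => (L μ : ℂ)) h c δ z) with hl
    have hld : DifferentiableOn ℂ l (Metric.ball (x : ℂ) R) := fun z hz =>
      ((hball z hz).1.clog (hball z hz).2.1).differentiableWithinAt
    have hlL : ∀ μ : ℝ, (μ : ℂ) ∈ Metric.ball (x : ℂ) R → l μ = L μ := by
      intro μ _
      rw [hl]
      simp only
      rw [hW, ← Complex.ofReal_exp, ← Complex.ofReal_log (Real.exp_pos _).le, Real.log_exp]
    obtain ⟨r, hr, g, hgd, hg1, hg2⟩ :=
      cauchyTransform_continuation hLc hR hld hlL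
    have hshift : ∀ z ∈ Metric.ball w (min r R),
        z + Complex.I * h / 2 ∈ Metric.ball (x : ℂ) (min r R) := by
      intro z hz
      rwa [Metric.mem_ball, ← hwx, dist_add_right]
    have hsr : Metric.ball (x : ℂ) (min r R) ⊆ Metric.ball (x : ℂ) r :=
      Metric.ball_subset_ball (min_le_left _ _)
    have hsR : Metric.ball (x : ℂ) (min r R) ⊆ Metric.ball (x : ℂ) R :=
      Metric.ball_subset_ball (min_le_right _ _)
    refine ⟨min r R, lt_min hr hR, fun z => Complex.exp (-(1 / (2 * Complex.I * Real.pi) *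
      g (z + Complex.I * h / 2))) * G z, ?_, ?_, ?_⟩
    · intro z hz
      have hg' : DifferentiableAt ℂ (fun z => g (z + Complex.I * h / 2)) z :=
        (hgd.differentiableAt (Metric.isOpen_ball.mem_nhds (hsr (hshift z hz)))).comp z
          (f := fun z => z + Complex.I * h / 2) (by fun_prop)
      exact ((hg'.const_mul _).neg.cexp.mul (hGd z)).differentiableWithinAt
    · intro z hz hza
      simp only
      rw [hg1 _ (hsr (hshift z hz)) (by rw [im_add_I_mul_half]; linarith), hA, cauchyUp]
    · intro z hz hza
      obtain ⟨-, hsl, hne⟩ := hball _ (hsR (hshift z hz))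
      have hpi : (Real.pi : ℂ) ≠ 0 := by exact_mod_cast Real.pi_ne_zero
      simp only
      rw [hg2 _ (hsr (hshift z hz)) (by rw [im_add_I_mul_half]; linarith)]
      have e1 : -(1 / (2 * Complex.I * Real.pi) *
          (cauchyTransform (fun μ => (L μ : ℂ)) (z + Complex.I * h / 2) -
            2 * Real.pi * Complex.I * l (z + Complex.I * h / 2))) =
          l (z + Complex.I * h / 2) - 1 / (2 * Complex.I * Real.pi) *
            cauchyTransform (fun μ => (L μ : ℂ)) (z + Complex.I * h / 2) := by
        field_simp [Complex.I_ne_zero]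
        ring
      have e2 : z + Complex.I * h / 2 = z + h * Complex.I - Complex.I * h / 2 := by ring
      have e3 : z + Complex.I * h / 2 + Complex.I * h / 2 = z + h * Complex.I := by ring
      have e4 : z + Complex.I * h / 2 - Complex.I * h / 2 = z := by ring
      have hB' : Complex.exp (1 / (2 * Complex.I * Real.pi) *
          cauchyTransform (fun μ => (L μ : ℂ)) (z + Complex.I * h / 2)) =
          B (z + h * Complex.I) := by
        rw [e2, hB, cauchyDown]
      rw [e1, Complex.exp_sub, hB', hl]
      simp only
      -- Exponentiating the jump turns log W into the factor W, and the remaining lower Cauchy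
      -- transform into 1/B(z + ih).
      rw [Complex.exp_log (Complex.slitPlane_ne_zero hsl), wronskian, e3, e4, ← hA, ← hB]
      simp only [hp, hq]
      have hGz : G z = (-Complex.I / h) ^ N * vartheta δ (z + h * Complex.I) *
        G (z + h * Complex.I) := gammaProd_eq_mul_vartheta hh.ne' δ z
      rw [hGz]
      rw [e3] at hne
      have hv : vartheta δ z ≠ 0 := by
        refine vartheta_ne_zero hδ (le_trans ?_ (neg_le_abs z.im))
        linarith
      have hb := cauchyDown_ne_zero (fun μ => (L μ : ℂ)) h (z + h * Complex.I)
      rw [← hB] at hb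
      generalize vartheta δ z = v at *
      generalize vartheta δ (z + h * Complex.I) = v' at *
      generalize B (z + h * Complex.I) = b at *
      field_simp)
  obtain ⟨E, hEd, hE⟩ := exists_entire_extension hh hpd hqd hHd (by
    intro z hz hza
    rw [hH2 z hza, hH1 _ (by rw [him]; linarith)])
  refine ⟨E, hEd, fun z hz => ?_⟩
  rw [hE z (by linarith), hH1 z hz]

/-! ### The Poisson bound for v↑. -/

theorem inv_sub_sq_add_sq_eq (x μ : ℝ) {y : ℝ} (hy : y ≠ 0) :
    ((x - μ) ^ 2 + y ^ 2)⁻¹ = (y ^ 2)⁻¹ * (1 + ((x - μ) / y) ^ 2)⁻¹ := by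
  rw [← mul_inv]; congr 1; field_simp; ring

theorem integrable_inv_sub_sq_add_sq (x : ℝ) {y : ℝ} (hy : y ≠ 0) :
    Integrable fun μ : ℝ => ((x - μ) ^ 2 + y ^ 2)⁻¹ := by
  simp only [inv_sub_sq_add_sq_eq x _ hy]
  exact ((integrable_inv_one_add_sq.comp_div hy).comp_sub_left x).const_mul _

theorem integral_inv_sub_sq_add_sq (x : ℝ) {y : ℝ} (hy : 0 < y) :
    ∫ μ : ℝ, ((x - μ) ^ 2 + y ^ 2)⁻¹ = Real.pi / y := by
  simp only [inv_sub_sq_add_sq_eq x _ hy.ne']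
  rw [integral_const_mul,
    integral_sub_left_eq_self (fun t : ℝ => (1 + (t / y) ^ 2)⁻¹) volume x,
    Measure.integral_comp_div (fun t : ℝ => (1 + t ^ 2)⁻¹), integral_univ_inv_one_add_sq,
    abs_of_pos hy, smul_eq_mul]
  field_simp

/-- The Poisson integral bound: `|v↑| ≤ exp (M / 2)` if the density lies in `[0, M]`. -/
theorem norm_cauchyUp_le {L : ℝ → ℝ} (hL : Integrable L) {M : ℝ} (hM : ∀ μ, L μ ≤ M) {h : ℝ}
    {z : ℂ} (hz : -(h / 2) < z.im) :
    ‖cauchyUp (fun μ => (L μ : ℂ)) h z‖ ≤ Real.exp (M / 2) := by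
  have hzi : 0 < (z + Complex.I * h / 2).im := by rw [im_add_I_mul_half]; linarith
  rw [cauchyUp, Complex.norm_exp]
  generalize z + Complex.I * h / 2 = w at hzi
  apply Real.exp_le_exp.2
  have hpi := Real.pi_pos
  have hpc : (Real.pi : ℂ) ≠ 0 := by exact_mod_cast hpi.ne'
  -- As -1/(2πi) = i/(2π), the real part of the exponent is half the Poisson integral of L, whose
  -- kernel has mass 1.
  have e1 : -(1 / (2 * Complex.I * Real.pi) * cauchyTransform (fun μ => (L μ : ℂ)) w) =
      ((1 / (2 * Real.pi) : ℝ) : ℂ) * (Complex.I * cauchyTransform (fun μ => (L μ : ℂ)) w) := by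
    push_cast
    field_simp [Complex.I_ne_zero]
    rw [Complex.I_sq]; ring
  have hi := integrable_div_sub hL.ofReal hzi.ne'
  have e2 : (cauchyTransform (fun μ => (L μ : ℂ)) w).im =
      ∫ μ : ℝ, -(L μ * w.im * ((w.re - μ) ^ 2 + w.im ^ 2)⁻¹) := by
    rw [cauchyTransform]
    refine (integral_im hi).symm.trans (integral_congr_ae (Eventually.of_forall fun μ => ?_))
    change ((L μ : ℂ) / (w - μ)).im = _
    rw [Complex.div_im, Complex.normSq_apply]
    simp
    ring
  have hint : Integrable fun μ : ℝ => L μ * w.im * ((w.re - μ) ^ 2 + w.im ^ 2)⁻¹ := by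
    have := hi.im.neg
    refine this.congr (Eventually.of_forall fun μ => ?_)
    change -((L μ : ℂ) / (w - μ)).im = _
    rw [Complex.div_im, Complex.normSq_apply]
    simp
    ring
  have e3 : ∫ μ : ℝ, L μ * w.im * ((w.re - μ) ^ 2 + w.im ^ 2)⁻¹ ≤ M * Real.pi := by
    calc _ ≤ ∫ μ : ℝ, M * w.im * ((w.re - μ) ^ 2 + w.im ^ 2)⁻¹ := by
          refine integral_mono hint
            ((integrable_inv_sub_sq_add_sq w.re hzi.ne').const_mul _) fun μ => ?_
          have := hM μ
          simp only
          gcongr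
      _ = M * Real.pi := by
          rw [integral_const_mul, integral_inv_sub_sq_add_sq _ hzi]
          field_simp
  rw [e1, Complex.re_ofReal_mul, Complex.I_mul_re, e2, integral_neg, neg_neg]
  calc _ ≤ 1 / (2 * Real.pi) * (M * Real.pi) := by gcongr
    _ = M / 2 := by field_simp

/-! ### Symmetry under complex conjugation. -/

theorem conj_cauchyTransform (L : ℝ → ℝ) (z : ℂ) :
    (starRingEnd ℂ) (cauchyTransform (fun μ => (L μ : ℂ)) ((starRingEnd ℂ) z)) =
      cauchyTransform (fun μ => (L μ : ℂ)) z := by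
  rw [cauchyTransform, cauchyTransform, ← integral_conj]
  simp

theorem conj_cauchyUp (L : ℝ → ℝ) (h : ℝ) (z : ℂ) :
    (starRingEnd ℂ) (cauchyUp (fun μ => (L μ : ℂ)) h ((starRingEnd ℂ) z)) =
      cauchyDown (fun μ => (L μ : ℂ)) h z := by
  have h1 : (starRingEnd ℂ) z + Complex.I * h / 2 =
      (starRingEnd ℂ) (z - Complex.I * h / 2) := by
    simp [Complex.conj_ofNat]; ring
  rw [cauchyUp, ← Complex.exp_conj, map_neg, map_mul, h1, conj_cauchyTransform, cauchyDown]
  congr 1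
  simp [Complex.conj_ofNat]

theorem conj_gammaProd {N : ℕ} {h : ℝ} {δ : Fin N → ℂ} (hδ : SelfConjugate δ) (z : ℂ) :
    (starRingEnd ℂ) (gammaProd h δ ((starRingEnd ℂ) z)) =
      ∏ k, (Complex.Gamma (1 + Complex.I * (z - δ k) / h))⁻¹ := by
  obtain ⟨σ, hσ⟩ := hδ
  rw [gammaProd, map_prod, ← Equiv.prod_comp σ]
  refine Finset.prod_congr rfl fun k _ => ?_
  rw [map_inv₀, ← Complex.Gamma_conj, ← hσ k]
  congr 2
  simp
  ring

theorem conj_vartheta {N : ℕ} {δ : Fin N → ℂ} (hδ : SelfConjugate δ) (z : ℂ) :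
    (starRingEnd ℂ) (vartheta δ z) = vartheta δ ((starRingEnd ℂ) z) := by
  obtain ⟨σ, hσ⟩ := hδ
  rw [vartheta, vartheta, map_prod]
  conv_rhs => rw [← Equiv.prod_comp σ]
  refine Finset.prod_congr rfl fun k _ => ?_
  rw [map_sub, hσ k]

/-- This removes the shifts Im δₖ from the total power of |z| in the growth estimate. -/
theorem sum_im_eq_zero {N : ℕ} {δ : Fin N → ℂ} (hδ : SelfConjugate δ) :
    ∑ k, (δ k).im = 0 := by
  obtain ⟨σ, hσ⟩ := hδ
  have h : ∑ k, (δ k).im = -∑ k, (δ k).im := by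
    conv_lhs => rw [← Equiv.sum_comp σ]
    rw [← Finset.sum_neg_distrib]
    refine Finset.sum_congr rfl fun k _ => ?_
    rw [← hσ k, Complex.conj_im]
  linarith

theorem vartheta_mul_vartheta {N : ℕ} {δ : Fin N → ℂ} (hδ : SelfConjugate δ) (h μ : ℝ) :
    vartheta δ ((μ : ℂ) - Complex.I * h / 2) * vartheta δ ((μ : ℂ) + Complex.I * h / 2) =
      ((‖vartheta δ ((μ : ℂ) - Complex.I * h / 2)‖ ^ 2 : ℝ) : ℂ) := by
  have h1 : (μ : ℂ) + Complex.I * h / 2 = (starRingEnd ℂ) ((μ : ℂ) - Complex.I * h / 2) := by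
    simp [Complex.conj_ofNat]; ring
  rw [h1, ← conj_vartheta hδ, Complex.mul_conj, Complex.normSq_eq_norm_sq]

/-! ### Decay of the density and the integral equation. -/

theorem exists_mul_one_add_sq_le (a : ℝ) {b : ℝ} (hb : b ≠ 0) :
    ∃ c > 0, ∀ μ : ℝ, c * (1 + μ ^ 2) ≤ (μ - a) ^ 2 + b ^ 2 := by
  have hb2 : 0 < b ^ 2 := by positivity
  -- From μ² ≤ 2(μ - a)² + 2a²: the constant part 1 + 2a² is absorbed by b², the rest by the
  -- coefficient 2.
  refine ⟨((1 + 2 * a ^ 2) / b ^ 2 + 2)⁻¹, by positivity, fun μ => ?_⟩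
  rw [inv_mul_le_iff₀ (by positivity)]
  have h1 : (1 + 2 * a ^ 2) / b ^ 2 * b ^ 2 = 1 + 2 * a ^ 2 := by field_simp
  have h2 : 0 ≤ (1 + 2 * a ^ 2) / b ^ 2 * (μ - a) ^ 2 := by positivity
  nlinarith [sq_nonneg (μ - 2 * a)]

theorem exists_mul_one_add_sq_le_norm_vartheta {N : ℕ} (hN : 1 ≤ N) {δ : Fin N → ℂ} {h : ℝ}
    (hδ : ∀ k, |(δ k).im| < h / 2) :
    ∃ c > 0, ∀ μ : ℝ, c * (1 + μ ^ 2) ≤ ‖vartheta δ ((μ : ℂ) - Complex.I * h / 2)‖ ^ 2 := by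
  have hb : ∀ k, h / 2 + (δ k).im ≠ 0 := fun k => by
    have : 0 < h / 2 + (δ k).im := by linarith [(abs_lt.1 (hδ k)).1]
    exact this.ne'
  choose c hc0 hc using fun k => exists_mul_one_add_sq_le (δ k).re (hb k)
  refine ⟨∏ k, c k, Finset.prod_pos fun k _ => hc0 k, fun μ => ?_⟩
  have h1 : ∏ k, (c k * (1 + μ ^ 2)) ≤ ‖vartheta δ ((μ : ℂ) - Complex.I * h / 2)‖ ^ 2 := by
    rw [vartheta, norm_prod, ← Finset.prod_pow]
    refine Finset.prod_le_prod (fun k _ => mul_nonneg (hc0 k).le (by positivity)) fun k _ => ?_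
    refine (hc k μ).trans_eq ?_
    rw [Complex.sq_norm, Complex.normSq_apply, Complex.sub_im, im_sub_I_mul_half, Complex.sub_re]
    have : ((μ : ℂ) - Complex.I * h / 2).re = μ := by
      have : Complex.I * h / 2 = ((h / 2 : ℝ) : ℂ) * Complex.I := by push_cast; ring
      rw [this]; simp
    rw [this, Complex.ofReal_im]
    ring
  refine le_trans ?_ h1
  rw [Finset.prod_mul_distrib, Finset.prod_const, Finset.card_univ, Fintype.card_fin]
  have h2 : 0 ≤ ∏ k, c k := Finset.prod_nonneg fun k _ => (hc0 k).le
  refine mul_le_mul_of_nonneg_left ?_ h2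
  -- Here N ≥ 1 enters: one quadratic factor already gives integrability.
  exact le_self_pow₀ (by nlinarith [sq_nonneg μ]) (by omega)

/-- The real-valued density `ln (1 + ρ^ħ Y / |ϑ|²)`. -/
noncomputable def density {N : ℕ} (h g κ : ℝ) (δ : Fin N → ℂ) (Y : ℝ → ℝ) (μ : ℝ) : ℝ :=
  Real.log (1 + rho N g κ ^ h * Y μ / ‖vartheta δ ((μ : ℂ) - Complex.I * h / 2)‖ ^ 2)

section Density

variable {N : ℕ} {h g κ : ℝ} {δ : Fin N → ℂ} {Y : ℝ → ℝ}

theorem rho_rpow_pos (N : ℕ) (h : ℝ) (hg : 0 < g) (hκ : 0 < κ) : 0 < rho N g κ ^ h :=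
  Real.rpow_pos_of_pos (by unfold rho; positivity) _

theorem logV_eq_density (hδ : SelfConjugate δ) (hg : 0 < g) (hκ : 0 < κ) (hY : ∀ x, 0 < Y x)
    (μ : ℝ) : logV h g κ δ Y μ = (density h g κ δ Y μ : ℂ) := by
  have := rho_rpow_pos N h hg hκ
  have := hY μ
  rw [logV, density, vartheta_mul_vartheta hδ, Complex.ofReal_log (by positivity)]
  push_cast
  rfl

theorem density_nonneg (hg : 0 < g) (hκ : 0 < κ) (hY : ∀ x, 0 < Y x) (μ : ℝ) :
    0 ≤ density h g κ δ Y μ := by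
  have := rho_rpow_pos N h hg hκ
  have := hY μ
  exact Real.log_nonneg (le_add_of_nonneg_right (by positivity))

theorem exists_density_le (hN : 1 ≤ N) (hg : 0 < g) (hκ : 0 < κ)
    (hδ : ∀ k, |(δ k).im| < h / 2) (hY : IsNLIESolution h g κ δ Y) :
    ∃ D, 0 ≤ D ∧ ∀ μ, density h g κ δ Y μ ≤ D * (1 + μ ^ 2)⁻¹ := by
  obtain ⟨c, hc, hcv⟩ := exists_mul_one_add_sq_le_norm_vartheta hN hδ
  obtain ⟨C, hC⟩ := hY.log_bounded
  have hr := rho_rpow_pos N h hg hκ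
  refine ⟨rho N g κ ^ h * Real.exp C / c, by positivity, fun μ => ?_⟩
  have hy := hY.pos μ
  have hyC : Y μ ≤ Real.exp C := (Real.log_le_iff_le_exp hy).1 (hC μ)
  have hpos : 0 < c * (1 + μ ^ 2) := by positivity
  have hv := hcv μ
  have hvp := hpos.trans_le hv
  calc density h g κ δ Y μ
      ≤ rho N g κ ^ h * Y μ / ‖vartheta δ ((μ : ℂ) - Complex.I * h / 2)‖ ^ 2 := by
        rw [density]
        refine (Real.log_le_sub_one_of_pos (by positivity)).trans_eq (by ring)
    _ ≤ rho N g κ ^ h * Real.exp C / (c * (1 + μ ^ 2)) := by gcongr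
    _ = _ := by field_simp

theorem integrable_density (hN : 1 ≤ N) (hg : 0 < g) (hκ : 0 < κ)
    (hδ : ∀ k, |(δ k).im| < h / 2) (hY : IsNLIESolution h g κ δ Y) :
    Integrable (density h g κ δ Y) := by
  obtain ⟨D, -, hD⟩ := exists_density_le hN hg hκ hδ hY
  refine (integrable_inv_one_add_sq.const_mul D).mono' ?_ (Eventually.of_forall fun μ => ?_)
  · have hYc : Continuous Y := by
      have he : Y = fun x => Real.exp (Real.log (Y x)) :=
        funext fun x => (Real.exp_log (hY.pos x)).symm
      rw [he]
      exact Real.continuous_exp.comp hY.continuous_log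
    have hv : Continuous fun μ : ℝ => vartheta δ ((μ : ℂ) - Complex.I * h / 2) :=
      (differentiable_vartheta δ).continuous.comp (by fun_prop)
    have : Measurable (density h g κ δ Y) := by
      have := hYc.measurable
      have := hv.measurable
      unfold density
      fun_prop
    exact this.aestronglyMeasurable
  · rw [Real.norm_of_nonneg (density_nonneg hg hκ hY.pos μ)]
    exact hD μ

theorem upIntegrand_eq (hδ : SelfConjugate δ) (hg : 0 < g) (hκ : 0 < κ) (hY : ∀ x, 0 < Y x)
    (z : ℂ) : upIntegrand h g κ δ Y z = fun μ : ℝ => 1 / (2 * Complex.I * Real.pi) *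
      ((density h g κ δ Y μ : ℂ) / (z + Complex.I * h / 2 - μ)) := by
  funext μ
  rw [upIntegrand, logV_eq_density hδ hg hκ hY,
    show z - μ + Complex.I * h / 2 = z + Complex.I * h / 2 - μ by ring]
  ring

theorem downIntegrand_eq (hδ : SelfConjugate δ) (hg : 0 < g) (hκ : 0 < κ) (hY : ∀ x, 0 < Y x)
    (z : ℂ) : downIntegrand h g κ δ Y z = fun μ : ℝ => 1 / (2 * Complex.I * Real.pi) *
      ((density h g κ δ Y μ : ℂ) / (z - Complex.I * h / 2 - μ)) := by
  funext μ
  rw [downIntegrand, logV_eq_density hδ hg hκ hY,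
    show z - μ - Complex.I * h / 2 = z - Complex.I * h / 2 - μ by ring]
  ring

theorem vUp_eq_cauchyUp (hδ : SelfConjugate δ) (hg : 0 < g) (hκ : 0 < κ) (hY : ∀ x, 0 < Y x)
    (z : ℂ) : vUp h g κ δ Y z = cauchyUp (fun μ => (density h g κ δ Y μ : ℂ)) h z := by
  rw [vUp, cauchyUp, upIntegrand_eq hδ hg hκ hY, integral_const_mul, cauchyTransform]

theorem vDownShift_eq_cauchyDown (hδ : SelfConjugate δ) (hg : 0 < g) (hκ : 0 < κ)
    (hY : ∀ x, 0 < Y x) (z : ℂ) :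
    vDownShift h g κ δ Y z = cauchyDown (fun μ => (density h g κ δ Y μ : ℂ)) h z := by
  rw [vDownShift, cauchyDown, downIntegrand_eq hδ hg hκ hY, integral_const_mul, cauchyTransform]

/-- The integral equation says that `Y(x) = v↑(x + iħ/2) v↓(x - iħ/2)` on the real line. -/
theorem cauchyUp_mul_cauchyDown_eq (hN : 1 ≤ N) (hh : 0 < h) (hg : 0 < g) (hκ : 0 < κ)
    (hδ : ∀ k, |(δ k).im| < h / 2) (hY : IsNLIESolution h g κ δ Y) (x : ℝ) :
    cauchyUp (fun μ => (density h g κ δ Y μ : ℂ)) h (x + Complex.I * h / 2) *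
      cauchyDown (fun μ => (density h g κ δ Y μ : ℂ)) h (x - Complex.I * h / 2) = Y x := by
  have hi : Integrable fun μ => (density h g κ δ Y μ : ℂ) :=
    (integrable_density hN hg hκ hδ hY).ofReal
  set L := density h g κ δ Y with hLdef
  have hup : ((x : ℂ) + Complex.I * h / 2 + Complex.I * h / 2).im = h := by
    rw [im_add_I_mul_half, im_add_I_mul_half, Complex.ofReal_im]; ring
  have hdn : ((x : ℂ) - Complex.I * h / 2 - Complex.I * h / 2).im = -h := by
    rw [im_sub_I_mul_half, im_sub_I_mul_half, Complex.ofReal_im]; ring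
  have hiu := integrable_div_sub hi (by rw [hup]; exact hh.ne')
  have hid := integrable_div_sub hi (by rw [hdn]; exact (neg_neg_of_pos hh).ne)
  rw [cauchyUp, cauchyDown, ← Complex.exp_add, cauchyTransform, cauchyTransform]
  rw [← Real.exp_log (hY.pos x), Complex.ofReal_exp]
  congr 1
  rw [hY.nlie x, ← integral_complex_ofReal, ← integral_const_mul, ← integral_const_mul,
    neg_add_eq_sub, ← integral_sub (hid.const_mul _) (hiu.const_mul _)]
  refine integral_congr_ae (Eventually.of_forall fun μ => ?_)
  have h1 := sub_ofReal_ne_zero (by rw [hup]; exact hh.ne') μ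
  have h2 := sub_ofReal_ne_zero (by rw [hdn]; exact (neg_neg_of_pos hh).ne) μ
  have hpi : (Real.pi : ℂ) ≠ 0 := by exact_mod_cast Real.pi_ne_zero
  have e1 : (x : ℂ) + Complex.I * h / 2 + Complex.I * h / 2 - μ = x - μ + Complex.I * h := by ring
  have e2 : (x : ℂ) - Complex.I * h / 2 - Complex.I * h / 2 - μ = x - μ - Complex.I * h := by ring
  rw [e1] at h1
  rw [e2] at h2
  -- Partial fractions: 1/(x - μ - ih) - 1/(x - μ + ih) is 2πi times the kernel.
  have e3 : ((x : ℂ) - μ) ^ 2 + h ^ 2 = (x - μ + Complex.I * h) * (x - μ - Complex.I * h) := by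
    linear_combination (h : ℂ) ^ 2 * Complex.I_sq
  have e4 : ((kernelK h (x - μ) : ℝ) : ℂ) =
      h / (Real.pi * ((x - μ + Complex.I * h) * (x - μ - Complex.I * h))) := by
    rw [← e3, kernelK]; push_cast; rfl
  change _ = ((kernelK h (x - μ) * L μ : ℝ) : ℂ)
  rw [Complex.ofReal_mul, e4]
  simp only
  rw [e1, e2]
  field_simp [Complex.I_ne_zero]
  ring

theorem wronskian_density (hN : 1 ≤ N) (hh : 0 < h) (hg : 0 < g) (hκ : 0 < κ)
    (hδ : SelfConjugate δ) (hδs : ∀ k, |(δ k).im| < h / 2) (hY : IsNLIESolution h g κ δ Y)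
    (x : ℝ) : wronskian (fun μ => (density h g κ δ Y μ : ℂ)) h (rho N g κ ^ h) δ x =
      Complex.exp (density h g κ δ Y x) := by
  have := rho_rpow_pos N h hg hκ
  have := hY.pos x
  rw [wronskian, cauchyUp_mul_cauchyDown_eq hN hh hg hκ hδs hY, vartheta_mul_vartheta hδ,
    ← Complex.ofReal_exp, density, Real.exp_log (by positivity)]
  push_cast
  rfl

end Density

/-! ### Growth in the strip. -/

theorem rpow_le_mul_rpow_of_comparable {x y c d e : ℝ} (hx : 0 < x) (hy : 0 < y) (hc : 1 ≤ c)
    (hd : 1 ≤ d) (hxy : x ≤ c * y) (hyx : y ≤ d * x) (he : |e| ≤ 2) :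
    x ^ e ≤ (c ^ (2 : ℝ) + d ^ (2 : ℝ)) * y ^ e := by
  have hc0 : 0 < c := by linarith
  have hd0 : 0 < d := by linarith
  have hye : 0 < y ^ e := Real.rpow_pos_of_pos hy e
  have hc2 : 0 < c ^ (2 : ℝ) := Real.rpow_pos_of_pos hc0 _
  have hd2 : 0 < d ^ (2 : ℝ) := Real.rpow_pos_of_pos hd0 _
  -- The exponent changes sign inside the strip, so both directions of the comparison are needed for
  -- a uniform constant.
  rcases le_total 0 e with h | h
  · calc x ^ e ≤ (c * y) ^ e := Real.rpow_le_rpow hx.le hxy h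
      _ = c ^ e * y ^ e := Real.mul_rpow hc0.le hy.le
      _ ≤ c ^ (2 : ℝ) * y ^ e := by
          gcongr
          exact (le_abs_self e).trans he
      _ ≤ _ := by rw [add_mul]; exact le_add_of_nonneg_right (mul_pos hd2 hye).le
  · have hdx : y / d ≤ x := by rwa [div_le_iff₀ hd0, mul_comm]
    calc x ^ e ≤ (y / d) ^ e := Real.rpow_le_rpow_of_nonpos (by positivity) hdx h
      _ = d ^ (-e) * y ^ e := by
          rw [Real.div_rpow hy.le hd0.le, Real.rpow_neg hd0.le]; ring
      _ ≤ d ^ (2 : ℝ) * y ^ e := by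
          gcongr
          exact (neg_le_abs e).trans he
      _ ≤ _ := by rw [add_mul]; exact le_add_of_nonneg_left (mul_pos hc2 hye).le

theorem eventually_stripEnds (h T : ℝ) :
    ∀ᶠ z in stripEnds h, T ≤ |z.re| ∧ |z.im| ≤ h / 2 :=
  ((tendsto_comap.eventually_ge_atTop T).filter_mono inf_le_left).and
    (Filter.mem_inf_of_right (mem_principal_self _))

theorem tendsto_conj_stripEnds (h : ℝ) :
    Tendsto (starRingEnd ℂ) (stripEnds h) (stripEnds h) := by
  refine tendsto_inf.2 ⟨tendsto_comap_iff.2 ?_, tendsto_principal.2 ?_⟩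
  · simpa [Function.comp_def, stripEnds] using (tendsto_comap (f := fun z : ℂ => |z.re|)).mono_left inf_le_left
  · filter_upwards [eventually_stripEnds h 0] with z hz using by simpa using hz.2

theorem isBigO_Gamma_inv {h : ℝ} (hh : 0 < h) {d : ℂ} (hd : |d.im| < h / 2) :
    (fun z : ℂ => (Complex.Gamma (1 - Complex.I * (z - d) / h))⁻¹) =O[stripEnds h]
      fun z : ℂ => Real.exp (Real.pi / (2 * h) * |z.re|) *
        ‖z‖ ^ (-(1 / 2) - (z.im - d.im) / h) := by
  obtain ⟨C, hC, hG⟩ := exists_norm_Gamma_inv_le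
  have hpi := Real.pi_pos
  refine Asymptotics.IsBigO.of_bound (C * ((1 + 2 / h) ^ (2 : ℝ) + (1 + 2 * h) ^ (2 : ℝ)) *
    Real.exp (Real.pi / (2 * h) * |d.re|)) ?_
  -- This threshold gives |Re(z - d)| ≥ h, hence |Im w| ≥ 1, and makes |z| and h|Im w| comparable
  -- within a factor 2.
  filter_upwards [eventually_stripEnds h (h + 2 * |d.re|)] with z hz
  obtain ⟨hzr, hzi⟩ := hz
  have hd' := abs_lt.1 hd
  have hzi' := abs_le.1 hzi
  have hd0 := abs_nonneg d.re
  have key : Complex.I * (z - d) / h = ((-(z.im - d.im) / h : ℝ) : ℂ) +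
      (((z.re - d.re) / h : ℝ) : ℂ) * Complex.I := by
    have hzd : z - d = ((z.re - d.re : ℝ) : ℂ) + ((z.im - d.im : ℝ) : ℂ) * Complex.I := by
      apply Complex.ext <;> simp
    rw [hzd]
    push_cast
    linear_combination (((z.im : ℂ) - d.im) / h) * Complex.I_sq
  set w := 1 - Complex.I * (z - d) / h with hw
  have hwre : w.re = 1 + (z.im - d.im) / h := by
    rw [hw, key, Complex.sub_re, Complex.add_re, Complex.ofReal_re, Complex.re_ofReal_mul]
    simp
    ring
  have hwim : |w.im| = |z.re - d.re| / h := by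
    rw [hw, key, Complex.sub_im, Complex.add_im, Complex.ofReal_im, Complex.im_ofReal_mul]
    simp [abs_div, abs_of_pos hh]
  have hlo : |z.re| - |d.re| ≤ |z.re - d.re| := abs_sub_abs_le_abs_sub _ _
  have hhi : |z.re - d.re| ≤ |z.re| + |d.re| := abs_sub _ _
  have hfr : -1 ≤ (z.im - d.im) / h ∧ (z.im - d.im) / h ≤ 1 := by
    rw [le_div_iff₀ hh, div_le_iff₀ hh]
    constructor <;> linarith [hd'.1, hd'.2, hzi'.1, hzi'.2]
  have hw1 : 1 ≤ |w.im| := by rw [hwim, le_div_iff₀ hh]; linarith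
  have hw0 : 0 < |w.im| := by linarith
  have hb := hG w (by rw [hwre]; linarith [hfr.1]) (by rw [hwre]; linarith [hfr.2]) hw1
  have hzre : |z.re| ≤ ‖z‖ := Complex.abs_re_le_norm z
  have hzn : ‖z‖ ≤ |z.re| + |z.im| := Complex.norm_le_abs_re_add_abs_im z
  have hz0 : 0 < ‖z‖ := by linarith
  have hcmp : |w.im| ^ (1 / 2 - w.re) ≤
      ((1 + 2 / h) ^ (2 : ℝ) + (1 + 2 * h) ^ (2 : ℝ)) * ‖z‖ ^ (1 / 2 - w.re) := by
    have h2h : 0 < 2 / h := by positivity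
    refine rpow_le_mul_rpow_of_comparable hw0 hz0 (by linarith) (by linarith) ?_ ?_ ?_
    · have : |w.im| ≤ 2 / h * ‖z‖ := by
        rw [hwim, div_mul_eq_mul_div]
        gcongr
        linarith
      nlinarith
    · have : ‖z‖ ≤ 2 * h * |w.im| := by
        rw [hwim]
        have : 2 * h * (|z.re - d.re| / h) = 2 * |z.re - d.re| := by field_simp
        rw [this]
        linarith
      nlinarith
    · rw [hwre, abs_le]
      constructor <;> linarith [hfr.1, hfr.2]
  have hexp : Real.exp (Real.pi / 2 * |w.im|) ≤
      Real.exp (Real.pi / (2 * h) * |d.re|) * Real.exp (Real.pi / (2 * h) * |z.re|) := by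
    rw [← Real.exp_add]
    apply Real.exp_le_exp.2
    rw [hwim]
    calc Real.pi / 2 * (|z.re - d.re| / h) ≤ Real.pi / 2 * ((|z.re| + |d.re|) / h) := by gcongr
      _ = _ := by field_simp; ring
  have hexpo : 1 / 2 - w.re = -(1 / 2) - (z.im - d.im) / h := by rw [hwre]; ring
  rw [Real.norm_of_nonneg (by positivity), ← hexpo]
  calc ‖(Complex.Gamma w)⁻¹‖
      ≤ C * |w.im| ^ (1 / 2 - w.re) * Real.exp (Real.pi / 2 * |w.im|) := hb
    _ ≤ C * (((1 + 2 / h) ^ (2 : ℝ) + (1 + 2 * h) ^ (2 : ℝ)) * ‖z‖ ^ (1 / 2 - w.re)) *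
        (Real.exp (Real.pi / (2 * h) * |d.re|) * Real.exp (Real.pi / (2 * h) * |z.re|)) := by
        gcongr
    _ = _ := by ring

theorem isBigO_gammaProd {N : ℕ} {h : ℝ} (hh : 0 < h) {δ : Fin N → ℂ} (hδ : SelfConjugate δ)
    (hδs : ∀ k, |(δ k).im| < h / 2) :
    gammaProd h δ =O[stripEnds h] fun z : ℂ => Real.exp (N * Real.pi / (2 * h) * |z.re|) *
      ‖z‖ ^ ((N : ℝ) / (2 * h) * (-2 * z.im - h)) := by
  have h1 := Asymptotics.IsBigO.finsetProd (s := Finset.univ)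
    fun k _ => isBigO_Gamma_inv hh (hδs k)
  refine h1.congr' EventuallyEq.rfl ?_
  filter_upwards [eventually_stripEnds h 1] with z hz
  have hz0 : 0 < ‖z‖ := by linarith [Complex.abs_re_le_norm z]
  rw [Finset.prod_mul_distrib, ← Real.exp_sum, ← Real.rpow_sum_of_pos hz0]
  have hsum : ∑ k, (-(1 / 2) - (z.im - (δ k).im) / h) =
      (N : ℝ) / (2 * h) * (-2 * z.im - h) := by
    rw [Finset.sum_sub_distrib, ← Finset.sum_div, Finset.sum_sub_distrib, sum_im_eq_zero hδ]
    simp only [Finset.sum_const, Finset.card_univ, Fintype.card_fin, nsmul_eq_mul]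
    field_simp
    ring
  rw [hsum, Finset.sum_const, Finset.card_univ, Fintype.card_fin, nsmul_eq_mul]
  congr 2
  ring

/-- An imaginary exponential is bounded in the strip. -/
theorem isBigO_cpow_one {b : ℝ} (hb : 0 < b) (c h : ℝ) :
    (fun z : ℂ => (b : ℂ) ^ (c * Complex.I * z)) =O[stripEnds h] fun _ => (1 : ℝ) := by
  refine Asymptotics.IsBigO.of_bound (Real.exp (|Real.log b * c| * (h / 2))) ?_
  filter_upwards [eventually_stripEnds h 0] with z hz
  rw [Complex.norm_cpow_eq_rpow_re_of_pos hb, Real.rpow_def_of_pos hb, norm_one, mul_one]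
  apply Real.exp_le_exp.2
  have : ((c : ℂ) * Complex.I * z).re = -(c * z.im) := by
    rw [mul_assoc, Complex.re_ofReal_mul, Complex.I_mul_re]; ring
  rw [this]
  calc Real.log b * -(c * z.im) ≤ |Real.log b * -(c * z.im)| := le_abs_self _
    _ = |Real.log b * c| * |z.im| := by rw [← abs_mul, ← abs_neg]; ring_nf
    _ ≤ _ := by gcongr; exact hz.2

/-- The closed strip contains the line Im z = -ħ/2, where E is known only as a continuation; the
bound passes there by continuity. -/
theorem norm_le_on_closed_halfPlane {E G : ℂ → ℂ} (hE : Continuous E) (hG : Continuous G)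
    {a K : ℝ} (hle : ∀ z : ℂ, a < z.im → ‖E z‖ ≤ K * ‖G z‖) {z : ℂ} (hz : a ≤ z.im) :
    ‖E z‖ ≤ K * ‖G z‖ := by
  have hcl : IsClosed {z : ℂ | ‖E z‖ ≤ K * ‖G z‖} :=
    isClosed_le hE.norm (continuous_const.mul hG.norm)
  have hsub : closure {z : ℂ | a < z.im} ⊆ {z : ℂ | ‖E z‖ ≤ K * ‖G z‖} :=
    closure_minimal hle hcl
  rw [Complex.closure_setOfPred_lt_im] at hsub
  exact hsub hz

/-- A tuple of prefactors bounded in the strip times the exponential times a function with the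
growth of the Gamma product has the growth claimed for the `Q`-functions. -/
theorem isBigO_prefactor_mul {h : ℝ} {P₁ P₂ X E : ℂ → ℂ} {F : ℂ → ℝ}
    (h₁ : P₁ =O[stripEnds h] fun _ => (1 : ℝ)) (h₂ : P₂ =O[stripEnds h] fun _ => (1 : ℝ))
    (hE : E =O[stripEnds h] F) :
    (fun z => P₁ z * P₂ z * X z * E z) =O[stripEnds h] fun z => ‖X z‖ * F z := by
  have hX : X =O[stripEnds h] fun z => ‖X z‖ := (Asymptotics.isBigO_refl X _).norm_right
  simpa using ((h₁.mul h₂).mul hX).mul hE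

end TodaTBA

/-! ### Assembly of the theorem. -/

theorem mainTheorem5 (N : ℕ) (hN : 1 ≤ N) (hbar g κ : ℝ) (hhbar : 0 < hbar) (hg : 0 < g)
    (hκ : 0 < κ) (δ : Fin N → ℂ) (hδconj : TodaTBA.SelfConjugate δ)
    (hδstrip : ∀ k, |(δ k).im| < hbar / 2)
    (Y : ℝ → ℝ) (hY : TodaTBA.IsNLIESolution hbar g κ δ Y) :
    (∀ z : ℂ, -(hbar / 2) < z.im →
      MeasureTheory.Integrable (TodaTBA.upIntegrand hbar g κ δ Y z) MeasureTheory.volume) ∧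
    (∀ z : ℂ, z.im < hbar / 2 →
      MeasureTheory.Integrable (TodaTBA.downIntegrand hbar g κ δ Y z) MeasureTheory.volume) ∧
    (∃ Qplus : ℂ → ℂ, Differentiable ℂ Qplus ∧
      (∀ z : ℂ, -(hbar / 2) < z.im → Qplus z = TodaTBA.QplusExpr hbar g κ δ Y z) ∧
      Asymptotics.IsBigO (TodaTBA.stripEnds hbar) Qplus (fun z : ℂ =>
        ‖Complex.exp (-(N * Real.pi / hbar) * z)‖ *
          (Real.exp (N * Real.pi / (2 * hbar) * |z.re|) *
            ‖z‖ ^ ((N : ℝ) / (2 * hbar) * (-2 * z.im - hbar))))) ∧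
    (∃ Qminus : ℂ → ℂ, Differentiable ℂ Qminus ∧
      (∀ z : ℂ, z.im < hbar / 2 → Qminus z = TodaTBA.QminusExpr hbar g κ δ Y z) ∧
      Asymptotics.IsBigO (TodaTBA.stripEnds hbar) Qminus (fun z : ℂ =>
        ‖Complex.exp (-(N * Real.pi / hbar) * z)‖ *
          (Real.exp (N * Real.pi / (2 * hbar) * |z.re|) *
            ‖z‖ ^ ((N : ℝ) / (2 * hbar) * (2 * z.im - hbar))))) := by

  have hL := TodaTBA.integrable_density hN hg hκ hδstrip hY
  have hLc : MeasureTheory.Integrable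
      fun μ => (TodaTBA.density hbar g κ δ Y μ : ℂ) := hL.ofReal
  obtain ⟨D, hD0, hD⟩ := TodaTBA.exists_density_le hN hg hκ hδstrip hY
  have hM : ∀ μ, TodaTBA.density hbar g κ δ Y μ ≤ D := fun μ =>
    (hD μ).trans (mul_le_of_le_one_right hD0 (inv_le_one_of_one_le₀ (by nlinarith [sq_nonneg μ])))
  obtain ⟨E, hEd, hE⟩ := TodaTBA.exists_entire_cauchyUp_mul_gammaProd hL hhbar hδstrip
    (TodaTBA.wronskian_density hN hhbar hg hκ hδconj hδstrip hY)
  have hEG : ∀ z : ℂ, -(hbar / 2) ≤ z.im →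
      ‖E z‖ ≤ Real.exp (D / 2) * ‖TodaTBA.gammaProd hbar δ z‖ := fun z hz =>
    TodaTBA.norm_le_on_closed_halfPlane hEd.continuous
      (TodaTBA.differentiable_gammaProd hbar δ).continuous (fun w hw => by
        rw [hE w hw, norm_mul]
        gcongr
        exact TodaTBA.norm_cauchyUp_le hL hM hw) hz
  have hEO : Asymptotics.IsBigO (TodaTBA.stripEnds hbar) E (fun z : ℂ =>
      Real.exp (N * Real.pi / (2 * hbar) * |z.re|) *
        ‖z‖ ^ ((N : ℝ) / (2 * hbar) * (-2 * z.im - hbar))) := by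
    refine Asymptotics.IsBigO.trans (Asymptotics.IsBigO.of_bound (Real.exp (D / 2)) ?_)
      (TodaTBA.isBigO_gammaProd hhbar hδconj hδstrip)
    filter_upwards [TodaTBA.eventually_stripEnds hbar 0] with z hz
    exact hEG z (abs_le.1 hz.2).1
  have hκg : 0 < κ * g ^ N := by positivity
  have hne : ∀ {b : ℝ}, 0 < b → (b : ℂ) ≠ 0 := fun hb => by exact_mod_cast hb.ne'
  -- The entire core of Q⁻ is conj (E (conj z)): conjugation exchanges v↑(z) with v↓(z - iħ) and the
  -- two Gamma products.
  refine ⟨fun z hz => ?_, fun z hz => ?_, ⟨fun z => ((κ * g ^ N : ℝ) : ℂ) ^ (-Complex.I * z) *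
      (hbar : ℂ) ^ (Complex.I * N * z / hbar) * Complex.exp (-(N * Real.pi / hbar) * z) * E z,
      ?_, fun z hz => ?_, ?_⟩, ⟨fun z => (g : ℂ) ^ (Complex.I * N * z) *
      (hbar : ℂ) ^ (-Complex.I * N * z / hbar) * Complex.exp (-(N * Real.pi / hbar) * z) *
      (starRingEnd ℂ) (E ((starRingEnd ℂ) z)), ?_, fun z hz => ?_, ?_⟩⟩
  · rw [TodaTBA.upIntegrand_eq hδconj hg hκ hY.pos]
    refine (TodaTBA.integrable_div_sub hLc ?_).const_mul _
    rw [TodaTBA.im_add_I_mul_half]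
    linarith
  · rw [TodaTBA.downIntegrand_eq hδconj hg hκ hY.pos]
    refine (TodaTBA.integrable_div_sub hLc ?_).const_mul _
    rw [TodaTBA.im_sub_I_mul_half]
    linarith
  · intro z
    refine DifferentiableAt.mul (DifferentiableAt.mul (DifferentiableAt.mul ?_ ?_) ?_) (hEd z)
    · exact DifferentiableAt.const_cpow (by fun_prop) (Or.inl (hne hκg))
    · exact DifferentiableAt.const_cpow (by fun_prop) (Or.inl (hne hhbar))
    · fun_prop
  · simp only
    rw [hE z hz, TodaTBA.QplusExpr, TodaTBA.vUp_eq_cauchyUp hδconj hg hκ hY.pos,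
      TodaTBA.gammaProd, Finset.prod_inv_distrib, div_eq_mul_inv]
    ring
  · refine TodaTBA.isBigO_prefactor_mul ?_ ?_ hEO
    · simpa using TodaTBA.isBigO_cpow_one hκg (-1) hbar
    · refine (TodaTBA.isBigO_cpow_one hhbar (N / hbar) hbar).congr_left fun z => ?_
      congr 1
      push_cast
      ring
  · intro z
    refine DifferentiableAt.mul (DifferentiableAt.mul (DifferentiableAt.mul ?_ ?_) ?_) ?_
    · exact DifferentiableAt.const_cpow (by fun_prop) (Or.inl (hne hg))
    · exact DifferentiableAt.const_cpow (by fun_prop) (Or.inl (hne hhbar))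
    · fun_prop
    · exact differentiableAt_conj_conj_iff.2 (hEd _)
  · have hz' : -(hbar / 2) < ((starRingEnd ℂ) z).im := by
      rw [Complex.conj_im]
      linarith
    simp only
    rw [hE _ hz', map_mul, TodaTBA.conj_cauchyUp, TodaTBA.conj_gammaProd hδconj,
      TodaTBA.QminusExpr, TodaTBA.vDownShift_eq_cauchyDown hδconj hg hκ hY.pos,
      Finset.prod_inv_distrib, div_eq_mul_inv]
    ring
  · have hconj : Asymptotics.IsBigO (TodaTBA.stripEnds hbar)
        (fun z => (starRingEnd ℂ) (E ((starRingEnd ℂ) z))) (fun z : ℂ =>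
        Real.exp (N * Real.pi / (2 * hbar) * |z.re|) *
          ‖z‖ ^ ((N : ℝ) / (2 * hbar) * (2 * z.im - hbar))) := by
      have h := (hEO.comp_tendsto (TodaTBA.tendsto_conj_stripEnds hbar)).norm_left
      refine Asymptotics.IsBigO.of_norm_left ?_
      simpa [Function.comp_def] using h
    refine TodaTBA.isBigO_prefactor_mul ?_ ?_ hconj
    · refine (TodaTBA.isBigO_cpow_one hg N hbar).congr_left fun z => ?_
      congr 1
      push_cast
      ring
    · refine (TodaTBA.isBigO_cpow_one hhbar (-(N / hbar)) hbar).congr_left fun z => ?_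
      congr 1
      push_cast
      ring
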